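/- **Theorem 5.4.** Let $K$ be an arbitrary field. For a field $L\supseteq K$ and a finite separable extension $L/L_0$ with $K\subseteq L_0\subseteq L$, say that $L/L_0$ is defined over a field $E_0$ with $K\subseteq E_0\subseteq L_0$ if there is a field $E$ with $E_0\subseteq E\subseteq L$, $[E:E_0]=[L:L_0]$ and $L=EL_0$; let $\mathrm{ed}_K(L/L_0)$ be the minimum of $\mathrm{trdeg}_K E_0$ over all fields $E_0$ over which $L/L_0$ is defined. For a finite group $G$ put $\mathrm{ed}_K(G)=\mathrm{ed}_K(K(V)/K(V)^G)$, where $G\to GL(V)$ is a faithful representation on a finite-dimensional $K$-vector space $V$ and $K(V)=K(x_1,\dots,x_m)$ ($x_1,\dots,x_m$ a basis of the dual space of $V$) is the function field of the affine space $V$; the inequalities below hold for every choice of the faithful representations that compute the essential dimensions occurring in them. Let $S_n$ be the symmetric group on $n$ letters. (1) If $\operatorname{char}K\neq 2$, then $$\mathrm{ed}_K(S_{n+2})\ \ge\ \mathrm{ed}_K(S_n)+1\quad\text{and}\quad \mathrm{ed}_K(S_n)\ \ge\ \left\lfloor \frac n2\right\rfloor\qquad\text{for every integer } n\ge 1.$$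 (2) If $\operatorname{char}K=2$ and $K$ contains the field $\mathbb F_4$ with four elements, then $$\mathrm{ed}_K(S_{n+3})\ \ge\ \mathrm{ed}_K(S_n)+1\qquad\text{for every integer } n\ge 0 \text{ with } n\ne 4.$$ (3) If $\operatorname{char}K=2$, then $$\mathrm{ed}_K(S_n)\ \ge\ \left\lfloor \frac{n+1}3\right\rfloor\qquad\text{for every integer } n\ge 1.$$ -/

import Mathlib

namespace EssDim

open MvPolynomial

universe u v

section Extensions

variable (K : Type u) {L : Type v} [Field K] [Field L] [Algebra K L]

/-- For a field `L ⊇ K` and an intermediate field `L₀`, the extension `L / L₀` is defined over the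
intermediate field `E₀ ⊆ L₀` if there is a field `E` with `L ⊇ E ⊇ E₀`, `[E : E₀] = [L : L₀]` and
`L = E L₀`. -/
def IsDefinedOver (L₀ E₀ : IntermediateField K L) : Prop :=
  E₀ ≤ L₀ ∧ ∃ E : IntermediateField K L, E₀ ≤ E ∧
    IntermediateField.relfinrank E₀ E = Module.finrank L₀ L ∧ E ⊔ L₀ = ⊤

/-- The essential dimension `ed_K(L/L₀)` of a finite separable extension `L / L₀` of fields
containing `K`: the minimum of the transcendence degrees over `K` of the intermediate fields `E₀`
over which `L / L₀` is defined. (The set is never empty, as `E₀ = L₀`, `E = L` is allowed.) -/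
noncomputable def extEssDim (L₀ : IntermediateField K L) : Cardinal.{v} :=
  sInf {d | ∃ E₀ : IntermediateField K L, IsDefinedOver K L₀ E₀ ∧ d = Algebra.trdeg K E₀}

end Extensions

section Representations

variable {K : Type u} [Field K] {G : Type v} [Group G] {m : ℕ}

/-- The `K`-algebra endomorphism of `K[x₁, …, x_m]` given by `x_i ↦ ∑ j, A i j * x_j`, that is
`f ↦ (v ↦ f (A v))`. -/
noncomputable def linSubst (A : Matrix (Fin m) (Fin m) K) :
    MvPolynomial (Fin m) K →ₐ[K] MvPolynomial (Fin m) K :=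
  aeval fun i => ∑ j, C (A i j) * X j

theorem linSubst_one : linSubst (1 : Matrix (Fin m) (Fin m) K) = AlgHom.id K _ := by
  ext1 i
  simp [linSubst, Matrix.one_apply]

theorem linSubst_comp (A B : Matrix (Fin m) (Fin m) K) :
    (linSubst A).comp (linSubst B) = linSubst (B * A) := by
  ext1 i
  simp only [linSubst, AlgHom.comp_apply, aeval_X, map_sum, map_mul, algHom_C, algebraMap_eq,
    Matrix.mul_apply, Finset.mul_sum, Finset.sum_mul]
  rw [Finset.sum_comm]
  simp only [mul_assoc]

/-- The action of `G` on the polynomial functions on `V = K^m` induced by a representation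
`ρ : G → GL(V)`: `(g • f)(v) = f (ρ(g)⁻¹ v)`, where `x₁, …, x_m` are the coordinate functions, i.e.
the dual basis of the standard basis of `V`. -/
noncomputable def polyAction (ρ : G →* GL (Fin m) K) :
    G →* (MvPolynomial (Fin m) K ≃ₐ[K] MvPolynomial (Fin m) K) where
  toFun g := AlgEquiv.ofAlgHom (linSubst (ρ g⁻¹ : Matrix (Fin m) (Fin m) K))
    (linSubst (ρ g : Matrix (Fin m) (Fin m) K))
    (by rw [linSubst_comp, ← Units.val_mul, ← map_mul, mul_inv_cancel, map_one, Units.val_one,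
          linSubst_one])
    (by rw [linSubst_comp, ← Units.val_mul, ← map_mul, inv_mul_cancel, map_one, Units.val_one,
          linSubst_one])
  map_one' := by
    ext1 p
    simp [linSubst_one]
  map_mul' g h := by
    ext1 p
    have := DFunLike.congr_fun (linSubst_comp (ρ g⁻¹ : Matrix (Fin m) (Fin m) K)
      (ρ h⁻¹ : Matrix (Fin m) (Fin m) K)) p
    rw [← Units.val_mul, ← map_mul, ← mul_inv_rev] at this
    exact this.symm

/-- The function field `K(V) = K(x₁, …, x_m)` of the affine space `V = K^m`. -/
abbrev RatFunField (K : Type u) [Field K] (m : ℕ) : Type u :=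
  FractionRing (MvPolynomial (Fin m) K)

/-- The induced action of `G` on `K(V)` by `K`-automorphisms. -/
noncomputable def fieldAction (ρ : G →* GL (Fin m) K) :
    G →* (RatFunField K m ≃ₐ[K] RatFunField K m) :=
  (IsFractionRing.fieldEquivOfAlgEquivHom (A := K) K (RatFunField K m)).comp (polyAction ρ)

/-- The field of invariants `K(V)^G`. -/
noncomputable def invariantField (ρ : G →* GL (Fin m) K) :
    IntermediateField K (RatFunField K m) :=
  IntermediateField.fixedField (fieldAction ρ).range

/-- `ed_K(K(V)/K(V)^G)` for a representation `ρ : G → GL(V)`, `V = K^m`. When `ρ` is faithful this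
is the essential dimension `ed_K(G)`. -/
noncomputable def repEssDim (ρ : G →* GL (Fin m) K) : Cardinal.{u} :=
  extEssDim K (invariantField ρ)

end Representations

end EssDim

namespace EssDim
open MvPolynomial
universe u v

/-! ### Transcendence degree as rank in the algebraic matroid -/

section Trdeg

variable {K : Type u} {L : Type v} [Field K] [Field L] [Algebra K L]

/-! For a finite group `G` acting faithfully on `L`, the essential dimension of `L / L^G` is the
least transcendence degree of a `G`-stable subfield on which `G` still acts faithfully. Such a
subfield of `K(V)` specializes, without gaining transcendence degree, to every infinite field with a
faithful action of `G` or of a group embedded in `G`, because equivariant maps `K[V] → L` are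
Zariski dense (`exists_isStableFaithful_of_fieldAction`). Independence of the representation and
monotonicity follow.

For the lower bounds, let `ℓ` be a prime different from the characteristic, with a primitive `ℓ`-th
root of unity `ζ` in `K`. The group `S_n × C_ℓ ⊆ S_{n+ℓ}` acts on `F(t)`, where `F` is a function
field for `S_n`: the first factor acts on coefficients, the second by `t ↦ ζ t`. The valuation at
infinity is invariant and `C_ℓ` acts trivially on its residue field `F`. On a stable faithful
subfield the valuation is therefore nontrivial, so the residue field of that subfield has smaller
transcendence degree. The tame character embeds inertia elements of order `ℓ` in the roots of unity,
and `C_ℓ` already fills these; so the kernel of `S_n` on the residue field has no element of order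
`ℓ` (`residueSubfield_of_tame`). Being normal, it is trivial unless `n = 3` for `ℓ = 2`, or `n = 2,
4` for `ℓ = 3`. This gives `ed(S_n) + 1 ≤ ed(S_{n+ℓ})`.

The exceptions `n = 3` for `ℓ = 2` and `n = 2` for `ℓ = 3` use `ed(S_2), ed(S_3) ≤ 1` and `ed(S_5) ≥
2`. In characteristic two the latter comes from the wild involution `t ↦ t + 1`
(`two_le_repEssDim`). The bound in characteristic two is proved over the algebraic closure and
descends by base change. -/

open AlgebraicIndependent in
theorem trdeg_le_mk_of_isAlgebraic_adjoin {E : IntermediateField K L} {s : Set L}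
    (h : ∀ x ∈ E, IsAlgebraic (Algebra.adjoin K s) x) : Algebra.trdeg K E ≤ Cardinal.mk s := by
  obtain ⟨t, ht⟩ := exists_isTranscendenceBasis K E
  rw [← ht.cardinalMk_eq_trdeg, ← Cardinal.mk_image_eq (f := E.val) (s := t) E.val.injective]
  have hind : (matroid K L).Indep (E.val '' t) := by
    rw [matroid_indep_iff]
    have := ht.1.map' (f := E.val) E.val.injective
    exact (algebraicIndependent_image (f := E.val) E.val.injective.injOn).1 this
  have hsub : E.val '' t ⊆ (matroid K L).closure s := by
    rintro _ ⟨x, -, rfl⟩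
    rw [matroid_closure_eq]
    exact h _ x.2
  calc _ = (matroid K L).cRk (E.val '' t) := hind.cRk_eq_cardinalMk
    _ ≤ (matroid K L).cRk ((matroid K L).closure s) := Matroid.cRk_mono _ hsub
    _ = (matroid K L).cRk s := Matroid.cRk_closure _ _
    _ ≤ _ := Matroid.cRk_le_cardinalMk _ _

-- Replacing `A` by a transcendence basis puts everything algebraic over `A` in the matroid closure
-- of a set of the right size.
open AlgebraicIndependent in
theorem exists_set_mk_eq_trdeg (A : Subalgebra K L) :
    ∃ s : Set L, Cardinal.mk s = Algebra.trdeg K A ∧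
      ∀ x : L, IsAlgebraic A x → IsAlgebraic (Algebra.adjoin K s) x := by
  obtain ⟨s, hs⟩ := exists_isTranscendenceBasis K A
  refine ⟨A.val '' s, ?_, fun x hx ↦ ?_⟩
  · rw [← hs.cardinalMk_eq_trdeg]
    exact Cardinal.mk_image_eq (f := A.val) Subtype.val_injective
  have hA : (A : Set L) ⊆ (matroid K L).closure (A.val '' s) := by
    intro a ha
    rw [matroid_closure_eq]
    have h1 : Algebra.IsAlgebraic (Algebra.adjoin K s) A := by
      have := hs.isAlgebraic
      rwa [Subtype.range_coe] at this
    let f : Algebra.adjoin K s →ₐ[K] Algebra.adjoin K (A.val '' s) :=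
      (A.val.comp (Algebra.adjoin K s).val).codRestrict _ fun y ↦ by
        rw [← AlgHom.map_adjoin]
        exact ⟨y, y.2, rfl⟩
    exact (h1.isAlgebraic ⟨a, ha⟩).ringHom_of_comp_eq f A.val
      (fun y z hyz ↦ Subtype.ext (Subtype.ext (Subtype.mk.inj hyz))) rfl
  have hx' : x ∈ (matroid K L).closure (A : Set L) := by
    rw [matroid_closure_eq]
    change IsAlgebraic (Algebra.adjoin K (A : Set L)) x
    rwa [Algebra.adjoin_eq]
  have := (matroid K L).closure_subset_closure_of_subset_closure hA hx'
  rwa [matroid_closure_eq] at this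

theorem trdeg_le_of_isAlgebraic {A : Subalgebra K L} {E : IntermediateField K L}
    (h : ∀ x ∈ E, IsAlgebraic A x) : Algebra.trdeg K E ≤ Algebra.trdeg K A := by
  obtain ⟨s, hs, hA⟩ := exists_set_mk_eq_trdeg A
  rw [← hs]
  exact trdeg_le_mk_of_isAlgebraic_adjoin fun x hx ↦ hA x (h x hx)

end Trdeg

/-! ### Essential dimension through stable faithful subfields -/

section StableFaithful

variable {K : Type u} {L : Type v} [Field K] [Field L] [Algebra K L] {G : Type*} [Group G]

/-- An intermediate field which is stable under a group of automorphisms, and on which this group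
acts faithfully. -/
def IsStableFaithful (α : G →* (L ≃ₐ[K] L)) (E : IntermediateField K L) : Prop :=
  (∀ g, ∀ x ∈ E, α g x ∈ E) ∧ ∀ g, (∀ x ∈ E, α g x = x) → g = 1

variable {α : G →* (L ≃ₐ[K] L)}

theorem mem_fixedField_range_iff (x : L) :
    x ∈ IntermediateField.fixedField α.range ↔ ∀ g, α g x = x := by
  simp [IntermediateField.mem_fixedField_iff]

theorem finrank_fixedField_range [Finite G] (hα : Function.Injective α) :
    Module.finrank (IntermediateField.fixedField α.range) L = Nat.card G := by
  have : Finite α.range := Set.finite_range α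
  cases nonempty_fintype α.range
  rw [Nat.card_congr (α.ofInjective hα).toEquiv, Nat.card_eq_fintype_card]
  exact FixedPoints.finrank_eq_card α.range L

theorem finiteDimensional_fixedField_range [Finite G] :
    FiniteDimensional (IntermediateField.fixedField α.range) L :=
  have : Finite α.range := Set.finite_range α
  inferInstanceAs (FiniteDimensional (FixedPoints.subfield α.range L) L)

/-- The field witnessing that the extension is defined over `E₀` need not be stable, but the
algebraic closure of `E₀` in `L` is, since `G` fixes `E₀`. It contains the witness, so an element of
`G` trivial on it is trivial on the compositum with `L^G`, which is `L`. -/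
theorem exists_isStableFaithful_of_isDefinedOver [Finite G] (hα : Function.Injective α)
    {E₀ : IntermediateField K L}
    (h : IsDefinedOver K (IntermediateField.fixedField α.range) E₀) :
    ∃ E, IsStableFaithful α E ∧ Algebra.trdeg K E ≤ Algebra.trdeg K E₀ := by
  obtain ⟨h0, E, hE, hfin, htop⟩ := h
  rw [finrank_fixedField_range hα] at hfin
  have hfd : FiniteDimensional E₀ (IntermediateField.extendScalars hE) := by
    apply FiniteDimensional.of_finrank_pos
    rw [← IntermediateField.relfinrank_eq_finrank_of_le hE, hfin]
    exact Nat.card_pos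
  have hEalg : ∀ x ∈ E, IsAlgebraic E₀ x := fun x hx ↦ by
    have : IsAlgebraic E₀ (⟨x, hx⟩ : IntermediateField.extendScalars hE) :=
      Algebra.IsAlgebraic.isAlgebraic _
    exact this.algebraMap
  refine ⟨(algebraicClosure E₀ L).restrictScalars K, ⟨fun g x hx ↦ ?_, fun g hg ↦ ?_⟩, ?_⟩
  · rw [IntermediateField.mem_restrictScalars, mem_algebraicClosure_iff] at hx ⊢
    obtain ⟨p, hp, hpx⟩ := hx
    refine ⟨p, hp, ?_⟩
    have : (α g : L →+* L).comp (algebraMap E₀ L) = algebraMap E₀ L := by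
      ext y
      exact (mem_fixedField_range_iff _).1 (h0 y.2) g
    have h2 := congrArg (α g) hpx
    rw [Polynomial.aeval_def] at h2 ⊢
    have h3 := Polynomial.hom_eval₂ p (algebraMap E₀ L) (α g : L →+* L) x
    rw [this] at h3
    simpa [h2] using h3.symm
  · apply hα
    rw [map_one]
    have hle : E ⊔ IntermediateField.fixedField α.range ≤
        IntermediateField.fixedField (Subgroup.zpowers (α g)) := by
      refine sup_le (fun x hx ↦ ?_) (IntermediateField.fixedField_le ?_)
      · rw [IntermediateField.mem_fixedField_iff]
        have h1 : Subgroup.zpowers (α g) ≤ MulAction.stabilizer (L ≃ₐ[K] L) x := by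
          rw [Subgroup.zpowers_le, MulAction.mem_stabilizer_iff]
          exact hg x (by
            rw [IntermediateField.mem_restrictScalars, mem_algebraicClosure_iff]
            exact hEalg x hx)
        exact fun f hf ↦ h1 hf
      · rw [Subgroup.zpowers_le]
        exact ⟨g, rfl⟩
    rw [htop] at hle
    ext x
    have := hle (IntermediateField.mem_top (x := x))
    rw [IntermediateField.mem_fixedField_iff] at this
    exact this _ (Subgroup.mem_zpowers _)
  · refine trdeg_le_of_isAlgebraic (A := E₀.toSubalgebra) fun x hx ↦ ?_
    rw [IntermediateField.mem_restrictScalars, mem_algebraicClosure_iff] at hx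
    exact hx

/-- Artin's theorem gives `[E : E^G] = |G|`. The compositum of `E` and `L^G` is `L` by Galois
theory: an automorphism fixing it comes from an element of `G` trivial on `E`. -/
theorem isDefinedOver_of_isStableFaithful [Finite G] (hα : Function.Injective α)
    {E : IntermediateField K L} (h : IsStableFaithful α E) :
    IsDefinedOver K (IntermediateField.fixedField α.range)
      (E ⊓ IntermediateField.fixedField α.range) := by
  refine ⟨inf_le_right, E, inf_le_left, ?_, ?_⟩
  · rw [finrank_fixedField_range hα]
    let _ : MulSemiringAction G E :=
      { smul := fun g x ↦ ⟨α g x, h.1 g x x.2⟩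
        one_smul := fun x ↦ Subtype.ext (by change α 1 (x : L) = x; simp)
        mul_smul := fun g k x ↦ Subtype.ext (by
          change α (g * k) (x : L) = α g (α k x); simp)
        smul_zero := fun g ↦ Subtype.ext (map_zero (α g))
        smul_add := fun g x y ↦ Subtype.ext (map_add (α g) _ _)
        smul_one := fun g ↦ Subtype.ext (map_one (α g))
        smul_mul := fun g x y ↦ Subtype.ext (map_mul (α g) _ _) }
    have hsm : ∀ (g : G) (x : E), ((g • x : E) : L) = α g x := fun _ _ ↦ rfl
    have : SMulCommClass G K E := ⟨fun g k x ↦ Subtype.ext (by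
      rw [hsm]; simp [hsm])⟩
    have : FaithfulSMul G E := ⟨fun {g k} hgk ↦ by
      rw [← inv_mul_eq_one, ]
      refine h.2 _ fun x hx ↦ ?_
      have := congrArg (Subtype.val) (hgk ⟨x, hx⟩)
      rw [hsm, hsm] at this
      simp only at this
      rw [map_mul, AlgEquiv.mul_apply, ← this, ← AlgEquiv.mul_apply, ← map_mul]
      simp⟩
    cases nonempty_fintype G
    have h1 : Module.finrank (FixedPoints.intermediateField G : IntermediateField K E) E =
        Nat.card G := by
      rw [Nat.card_eq_fintype_card]
      exact FixedPoints.finrank_eq_card G E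
    rw [← IntermediateField.relfinrank_top_right,
      ← IntermediateField.relfinrank_map_map _ _ E.val] at h1
    rw [← h1]
    congr 1
    · ext x
      simp only [IntermediateField.mem_inf, IntermediateField.mem_map, mem_fixedField_range_iff]
      constructor
      · rintro ⟨hx, hf⟩
        exact ⟨⟨x, hx⟩, fun g ↦ Subtype.ext (hf g), rfl⟩
      · rintro ⟨y, hy, rfl⟩
        exact ⟨y.2, fun g ↦ congrArg Subtype.val (hy g)⟩
    · ext x
      simp [IntermediateField.mem_map]
  · set L₀ := IntermediateField.fixedField α.range with hL
    have : FiniteDimensional L₀ L := finiteDimensional_fixedField_range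
    have : Finite α.range := Set.finite_range α
    have : IsGalois L₀ L := IsGalois.of_fixed_field L α.range
    have hle : L₀ ≤ E ⊔ L₀ := le_sup_right
    have hM : IntermediateField.extendScalars hle = ⊤ := by
      have hb : (IntermediateField.extendScalars hle).fixingSubgroup = ⊥ := by
        rw [eq_bot_iff]
        intro σ hσ
        rw [IntermediateField.mem_fixingSubgroup_iff] at hσ
        obtain ⟨⟨_, g, rfl⟩, hτ⟩ := FixedPoints.toAlgAut_surjective α.range L σ
        have h1 : ∀ x : L, σ x = α g x := fun x ↦ by rw [← hτ]; rfl
        have hg : g = 1 := h.2 g fun x hx ↦ by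
          rw [← h1]
          exact hσ x ((le_sup_left : E ≤ E ⊔ L₀) hx)
        rw [Subgroup.mem_bot]
        ext x
        rw [h1, hg, map_one]
        rfl
      rw [← IsGalois.fixedField_fixingSubgroup (IntermediateField.extendScalars hle), hb,
        IntermediateField.fixedField_bot]
    rw [eq_top_iff]
    intro x _
    have : x ∈ IntermediateField.extendScalars hle := hM ▸ IntermediateField.mem_top
    exact this

theorem trdeg_le_of_le {E E' : IntermediateField K L} (h : E ≤ E') :
    Algebra.trdeg K E ≤ Algebra.trdeg K E' :=
  trdeg_le_of_injective (IntermediateField.inclusion h)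
    (IntermediateField.inclusion_injective h)

theorem isStableFaithful_top (hα : Function.Injective α) : IsStableFaithful α ⊤ :=
  ⟨fun _ _ _ ↦ IntermediateField.mem_top, fun g hg ↦ hα (by
    ext x
    simpa using hg x IntermediateField.mem_top)⟩

theorem extEssDim_le_of_isStableFaithful [Finite G] (hα : Function.Injective α)
    {E : IntermediateField K L} (h : IsStableFaithful α E) :
    extEssDim K (IntermediateField.fixedField α.range) ≤ Algebra.trdeg K E :=
  have h1 := isDefinedOver_of_isStableFaithful hα h
  have h2 : extEssDim K (IntermediateField.fixedField α.range) ≤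
      Algebra.trdeg K (E ⊓ IntermediateField.fixedField α.range : IntermediateField K L) :=
    csInf_le' ⟨_, h1, rfl⟩
  h2.trans (trdeg_le_of_le inf_le_left)

theorem exists_isStableFaithful_trdeg_le_extEssDim [Finite G] (hα : Function.Injective α) :
    ∃ E, IsStableFaithful α E ∧
      Algebra.trdeg K E ≤ extEssDim K (IntermediateField.fixedField α.range) := by
  have hne : {d | ∃ E₀ : IntermediateField K L,
      IsDefinedOver K (IntermediateField.fixedField α.range) E₀ ∧
        d = Algebra.trdeg K E₀}.Nonempty := by
    have h := isDefinedOver_of_isStableFaithful hα (isStableFaithful_top hα)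
    exact Set.nonempty_of_mem (x := Algebra.trdeg K
      (⊤ ⊓ IntermediateField.fixedField α.range : IntermediateField K L)) ⟨_, h, rfl⟩
  obtain ⟨E₀, h, hd : extEssDim K (IntermediateField.fixedField α.range) = _⟩ := csInf_mem hne
  obtain ⟨E, hE, hle⟩ := exists_isStableFaithful_of_isDefinedOver hα h
  exact ⟨E, hE, hle.trans hd.ge⟩

/-- The restriction of a stable faithful field to a subgroup. -/
theorem IsStableFaithful.comp {H : Type*} [Group H] {E : IntermediateField K L}
    (h : IsStableFaithful α E) {f : H →* G} (hf : Function.Injective f) :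
    IsStableFaithful (α.comp f) E :=
  ⟨fun g ↦ h.1 (f g), fun g hg ↦ hf (by rw [h.2 (f g) hg, map_one])⟩

theorem infinite_fixed [Finite G] [Infinite L] (α : G →* (L ≃ₐ[K] L)) :
    {x : L | ∀ g, α g x = x}.Infinite := by
  have h1 := finiteDimensional_fixedField_range (α := α)
  have h2 : Infinite (IntermediateField.fixedField α.range) := by
    by_contra hfin
    rw [not_infinite_iff_finite] at hfin
    exact not_finite_iff_infinite.2 ‹Infinite L›
      (Module.finite_of_finite (IntermediateField.fixedField α.range))
  rw [← Set.infinite_coe_iff]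
  exact h2.of_injective (fun x ↦ ⟨x, (mem_fixedField_range_iff _).1 x.2⟩)
    fun x y hxy ↦ Subtype.ext (Subtype.mk.inj hxy)

end StableFaithful
end EssDim

namespace EssDim
open MvPolynomial
universe u

/-! ### Density of equivariant points and specialization -/

section Versal

variable {K L : Type u} [Field K] [Field L] [Algebra K L] {G : Type*} [Group G]
  {m : ℕ} {α : G →* (L ≃ₐ[K] L)}

/-- A finite family dual to the automorphisms in a finite group, by independence of characters. -/
theorem exists_dual_family [Finite G] (hα : Function.Injective α) :
    ∃ c : L →₀ L, ∀ h : G, (c.sum fun b a ↦ a * α h b) = Set.indicator {1} 1 h := by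
  have hli : LinearIndependent L (fun (h : G) (b : L) ↦ α h b) := by
    have := (linearIndependent_monoidHom L L).comp
      (fun h : G ↦ ((α h : L →+* L) : L →* L)) fun g h hgh ↦ hα (by
        ext b
        exact DFunLike.congr_fun hgh b)
    exact this
  have hspan := span_flip_eq_top_iff_linearIndependent.2 hli
  have hmem : (Set.indicator {1} 1 : G → L) ∈
      Submodule.span L (Set.range (flip fun (h : G) (b : L) ↦ α h b)) := hspan ▸ Submodule.mem_top
  obtain ⟨c, hc⟩ := Finsupp.mem_span_range_iff_exists_finsupp.1 hmem
  refine ⟨c, fun h ↦ ?_⟩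
  rw [← hc, Finsupp.sum, Finsupp.sum, Finset.sum_apply]
  rfl

theorem polyAction_X (ρ : G →* GL (Fin m) K) (g : G) (i : Fin m) :
    polyAction ρ g (X i) = ∑ j, C ((ρ g⁻¹ : Matrix (Fin m) (Fin m) K) i j) * X j := by
  change linSubst _ (X i) = _
  simp [linSubst]

theorem equivariant_of_forall_X {ρ : G →* GL (Fin m) K} {φ : MvPolynomial (Fin m) K →ₐ[K] L}
    {g : G} (h : ∀ i, φ (polyAction ρ g (X i)) = α g (φ (X i))) (f : MvPolynomial (Fin m) K) :
    φ (polyAction ρ g f) = α g (φ f) := by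
  have : φ.comp (polyAction ρ g).toAlgHom = (α g).toAlgHom.comp φ := by
    ext i
    exact h i
  exact DFunLike.congr_fun this f

/-- Rational points of a linear representation over a field with a faithful action are Zariski
dense. -/
theorem exists_equivariant_algHom [Finite G] (ρ : G →* GL (Fin m) K) (hα : Function.Injective α)
    (hinf : {x : L | ∀ g, α g x = x}.Infinite) {p : MvPolynomial (Fin m) K} (hp : p ≠ 0) :
    ∃ φ : MvPolynomial (Fin m) K →ₐ[K] L,
      (∀ g f, φ (polyAction ρ g f) = α g (φ f)) ∧ φ p ≠ 0 := by
  classical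
  cases nonempty_fintype G
  obtain ⟨c, hc⟩ := exists_dual_family hα
  let M : G → Fin m → Fin m → L := fun h i j ↦ algebraMap K L ((ρ h : Matrix (Fin m) (Fin m) K) i j)
  have hM : ∀ g h i j, M (g * h) i j = ∑ k, M g i k * M h k j := fun g h i j ↦ by
    simp only [M, map_mul, Units.val_mul, Matrix.mul_apply, map_sum]
  -- Coordinates of the twisted average `∑ h, ρ(h) α_h(∑ b, b y_b)` with indeterminate vectors
  -- `y_b`. Invariant values of the indeterminates yield an equivariant point.
  let ℓ : Fin m → MvPolynomial (Fin m × L) L := fun i ↦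
    ∑ j, ∑ b ∈ c.support, C (∑ h, M h i j * α h b) * X (j, b)
  have : Infinite L := Set.infinite_univ_iff.1 (hinf.mono (Set.subset_univ _))
  have hcomp : ∀ y : Fin m × L → L, aeval y (aeval ℓ p) = aeval (fun i ↦ aeval y (ℓ i)) p := by
    intro y
    have : ((aeval y : MvPolynomial (Fin m × L) L →ₐ[L] L).restrictScalars K).comp (aeval ℓ) =
        aeval fun i ↦ aeval y (ℓ i) := by
      ext i
      simp
    exact DFunLike.congr_fun this p
  -- At `y (j, b) = μ j * c b` the dual family leaves only the term `h = 1` of the average, which is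
  -- `μ`. These values need not be invariant, which is harmless for nonvanishing as a polynomial.
  have hq : aeval ℓ p ≠ 0 := by
    intro h0
    apply hp
    apply MvPolynomial.map_injective (algebraMap K L) (algebraMap K L).injective
    rw [map_zero]
    refine MvPolynomial.funext fun μ ↦ ?_
    have h1 := hcomp fun jb : Fin m × L ↦ μ jb.1 * c jb.2
    rw [h0, map_zero] at h1
    rw [eval_map, map_zero, ← aeval_def, h1]
    congr 2
    · ext i
      simp only [ℓ, map_sum, map_mul, aeval_X, algHom_C, Algebra.algebraMap_self, RingHom.id_apply]
      have h2 : ∀ j, ∑ b ∈ c.support, (∑ h, M h i j * α h b) * (μ j * c b) = μ j * M 1 i j := by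
        intro j
        calc _ = ∑ h, μ j * M h i j * (c.sum fun b a ↦ a * α h b) := by
              simp only [Finset.sum_mul, Finsupp.sum, Finset.mul_sum]
              rw [Finset.sum_comm]
              exact Finset.sum_congr rfl fun _ _ ↦ Finset.sum_congr rfl fun _ _ ↦ by ring
          _ = _ := by
              simp only [hc]
              rw [Finset.sum_eq_single 1 (fun h _ hh ↦ by simp [hh]) (by simp)]
              simp
      have h3 : ∑ j, μ j * M 1 i j = μ i := by
        simp [M, Matrix.one_apply]
      rw [← h3]
      exact Finset.sum_congr rfl fun j _ ↦ (h2 j).symm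
  -- The invariants are infinite in number, so a nonzero polynomial over `L` cannot vanish at all
  -- invariant tuples.
  obtain ⟨y, hy, hqy⟩ : ∃ y : Fin m × L → L, (∀ i, ∀ g, α g (y i) = y i) ∧
      aeval y (aeval ℓ p) ≠ 0 := by
    by_contra! hcon
    refine hq (MvPolynomial.funext_set (fun _ ↦ {x : L | ∀ g, α g x = x}) (fun _ ↦ hinf)
      fun y hy ↦ ?_)
    rw [map_zero, ← coe_aeval_eq_eval]
    exact hcon y fun i ↦ hy i trivial
  let w : Fin m → L := fun i ↦ aeval y (ℓ i)
  have hw : ∀ i, w i = ∑ j, ∑ b ∈ c.support, ∑ h, M h i j * α h b * y (j, b) := fun i ↦ by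
    simp only [w, ℓ, map_sum, map_mul, aeval_X, algHom_C, Algebra.algebraMap_self, RingHom.id_apply,
      Finset.sum_mul]
  refine ⟨aeval w, fun g f ↦ equivariant_of_forall_X (fun i ↦ ?_) f, ?_⟩
  · rw [polyAction_X, map_sum, aeval_X, hw, map_sum]
    have h1 : ∀ k, aeval w (C ((ρ g⁻¹ : Matrix (Fin m) (Fin m) K) i k) * X k) =
        M g⁻¹ i k * w k := fun k ↦ by
      rw [map_mul, aeval_X, algHom_C]
    have h2 : ∀ a b, α g (M a b i) = M a b i := fun a b ↦ AlgEquiv.commutes _ _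
    simp only [h1, hw, Finset.mul_sum]
    rw [Finset.sum_comm]
    refine Finset.sum_congr rfl fun j _ ↦ ?_
    rw [Finset.sum_comm, map_sum]
    refine Finset.sum_congr rfl fun b _ ↦ ?_
    rw [Finset.sum_comm, map_sum, ← Equiv.sum_comp (Equiv.mulLeft g)]
    refine Finset.sum_congr rfl fun h _ ↦ ?_
    simp only [Equiv.coe_mulLeft]
    have h3 : α g (M h i j) = M h i j := AlgEquiv.commutes _ _
    have h4 : M h i j = ∑ k, M g⁻¹ i k * M (g * h) k j := by
      rw [← hM, inv_mul_cancel_left]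
    rw [map_mul (α g), map_mul (α g), h3, hy, h4, Finset.sum_mul, Finset.sum_mul, map_mul α]
    exact Finset.sum_congr rfl fun _ _ ↦ by rw [AlgEquiv.mul_apply]; ring
  · rwa [← hcomp]

theorem fieldAction_algebraMap (ρ : G →* GL (Fin m) K) (g : G) (f : MvPolynomial (Fin m) K) :
    fieldAction ρ g (algebraMap _ (RatFunField K m) f) = algebraMap _ _ (polyAction ρ g f) := by
  simp [fieldAction]

open Localization in
/-- Stable faithful subfields of a function field of a representation specialize, without
increasing the transcendence degree, to any field with a faithful action. -/
theorem exists_isStableFaithful_of_fieldAction [Finite G] (ρ : G →* GL (Fin m) K)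
    (hα : Function.Injective α) (hinf : {x : L | ∀ g, α g x = x}.Infinite)
    {E : IntermediateField K (RatFunField K m)} (hE : IsStableFaithful (fieldAction ρ) E) :
    ∃ E' : IntermediateField K L, IsStableFaithful α E' ∧
      Algebra.trdeg K E' ≤ Algebra.trdeg K E := by
  classical
  cases nonempty_fintype G
  let R := MvPolynomial (Fin m) K
  let F := RatFunField K m
  have hx : ∀ g : G, ∃ x ∈ E, g ≠ 1 → fieldAction ρ g x ≠ x := fun g ↦ by
    by_cases hg : g = 1
    · exact ⟨0, zero_mem _, fun h ↦ (h hg).elim⟩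
    · by_contra! hcon
      exact hg (hE.2 g fun x hx ↦ (hcon x hx).2)
  choose x hxE hx using hx
  have hdiv : ∀ z : F, ∃ a s : R, s ≠ 0 ∧ z = algebraMap R F a * (algebraMap R F s)⁻¹ := fun z ↦ by
    obtain ⟨a, s, hs, rfl⟩ := IsFractionRing.div_surjective (A := R) z
    exact ⟨a, s, nonZeroDivisors.ne_zero hs, div_eq_mul_inv _ _⟩
  choose num den hden hnd using hdiv
  have hnum : ∀ z, z ≠ 0 → num z ≠ 0 := fun z hz h0 ↦ hz (by rw [hnd z, h0, map_zero, zero_mul])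
  -- If `φ p ≠ 0`, every `x g` is regular at the point `φ`, and for `g ≠ 1` its displacement by `g`
  -- stays nonzero there; so faithfulness survives specialization.
  let p : R := ∏ g, (den (x g) * (if g = 1 then 1 else
    num (fieldAction ρ g (x g) - x g) * den (fieldAction ρ g (x g) - x g)))
  have hp : p ≠ 0 := by
    refine Finset.prod_ne_zero_iff.2 fun g _ ↦ mul_ne_zero (hden _) ?_
    split_ifs with hg
    · exact one_ne_zero
    · exact mul_ne_zero (hnum _ (sub_ne_zero.2 (hx g hg))) (hden _)
  obtain ⟨φ, hφ, hφp⟩ := exists_equivariant_algHom ρ hα hinf hp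
  have hφp' : ∀ g, φ (den (x g)) ≠ 0 ∧ (g ≠ 1 → φ (num (fieldAction ρ g (x g) - x g)) ≠ 0 ∧
      φ (den (fieldAction ρ g (x g) - x g)) ≠ 0) := fun g ↦ by
    rw [map_prod, Finset.prod_ne_zero_iff] at hφp
    have := hφp g (Finset.mem_univ _)
    rw [map_mul] at this
    refine ⟨left_ne_zero_of_mul this, fun hg ↦ ?_⟩
    have h2 := right_ne_zero_of_mul this
    rw [if_neg hg, map_mul] at h2
    exact ⟨left_ne_zero_of_mul h2, right_ne_zero_of_mul h2⟩
  have hprime : (RingHom.ker φ).IsPrime := RingHom.ker_isPrime φ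
  let S : Submonoid R := (RingHom.ker φ).primeCompl
  have hS : ∀ s, s ∈ S ↔ φ s ≠ 0 := fun s ↦ Iff.rfl
  have hS' : S ≤ nonZeroDivisors R := (RingHom.ker φ).primeCompl_le_nonZeroDivisors
  -- The local ring at `ker φ`, to which `φ` extends. The specialized field is generated by the
  -- image of its intersection with `E`.
  let B : Subalgebra R F := subalgebra.ofField F S hS'
  have hB : ∀ z, z ∈ B ↔ ∃ a s : R, φ s ≠ 0 ∧ z = algebraMap R F a * (algebraMap R F s)⁻¹ :=
    fun z ↦ ⟨fun ⟨a, s, hs, h⟩ ↦ ⟨a, s, hs, h⟩, fun ⟨a, s, hs, h⟩ ↦ ⟨a, s, hs, h⟩⟩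
  let ψ : B →+* L := IsLocalization.lift (M := S) (S := B) (g := (φ : R →+* L))
    fun s ↦ IsUnit.mk0 _ ((hS s).1 s.2)
  have hψ : ∀ a, ψ (algebraMap R B a) = φ a := fun a ↦ IsLocalization.lift_eq _ _
  have hinj : Function.Injective (algebraMap R F) := IsFractionRing.injective R F
  have hs0 : ∀ s, φ s ≠ 0 → algebraMap R F s ≠ 0 := fun s hs h ↦ hs (by
    rw [(map_eq_zero_iff _ hinj).1 h, map_zero])
  have hψ' : ∀ (z : B) (a s : R), φ s ≠ 0 → (z : F) = algebraMap R F a * (algebraMap R F s)⁻¹ →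
      ψ z = φ a * (φ s)⁻¹ := fun z a s hs h ↦ by
    have h1 : z * algebraMap R B s = algebraMap R B a := Subtype.ext (by
      change (z : F) * algebraMap R F s = algebraMap R F a
      rw [h, inv_mul_cancel_right₀ (hs0 s hs)])
    rw [eq_mul_inv_iff_mul_eq₀ hs, ← hψ, ← hψ, ← map_mul, h1]
  have hstab : ∀ g a s, φ s ≠ 0 → φ (polyAction ρ g s) ≠ 0 ∧
      fieldAction ρ g (algebraMap R F a * (algebraMap R F s)⁻¹) =
        algebraMap R F (polyAction ρ g a) * (algebraMap R F (polyAction ρ g s))⁻¹ :=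
    fun g a s hs ↦ ⟨by rw [hφ]; simpa using hs, by
      rw [map_mul, map_inv₀, fieldAction_algebraMap, fieldAction_algebraMap]⟩
  have hgB : ∀ g, ∀ z ∈ B, fieldAction ρ g z ∈ B := fun g z hz ↦ by
    obtain ⟨a, s, hs, rfl⟩ := (hB z).1 hz
    exact (hB _).2 ⟨_, _, (hstab g a s hs).1, (hstab g a s hs).2⟩
  have hgψ : ∀ g z (hz : z ∈ B), ψ ⟨fieldAction ρ g z, hgB g z hz⟩ = α g (ψ ⟨z, hz⟩) :=
    fun g z hz ↦ by
      obtain ⟨a, s, hs, h⟩ := (hB z).1 hz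
      rw [hψ' ⟨z, hz⟩ a s hs h, hψ' _ _ _ (hstab g a s hs).1 ((congrArg _ h).trans (hstab g a s hs).2),
        hφ, hφ, map_mul, map_inv₀]
  let A : Subalgebra K F := E.toSubalgebra ⊓ B.restrictScalars K
  let χ : A →ₐ[K] L :=
    { toRingHom := ψ.comp
        { toFun := fun z ↦ ⟨z, z.2.2⟩, map_one' := rfl, map_zero' := rfl, map_mul' := fun _ _ ↦ rfl,
          map_add' := fun _ _ ↦ rfl }
      commutes' := fun k ↦ by
        have : φ (algebraMap K R k) = algebraMap K L k := φ.commutes k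
        rw [← this, ← hψ]
        rfl }
  have hχ : ∀ z : A, χ z = ψ ⟨z, z.2.2⟩ := fun z ↦ rfl
  have hxB : ∀ g, x g ∈ B := fun g ↦ (hB _).2 ⟨_, _, (hφp' g).1, hnd _⟩
  refine ⟨IntermediateField.adjoin K χ.range, ⟨fun g y hy ↦ ?_, fun g hg ↦ ?_⟩, ?_⟩
  · have hle : IntermediateField.adjoin K (χ.range : Set L) ≤
        (IntermediateField.adjoin K (χ.range : Set L)).comap (α g : L →ₐ[K] L) := by
      rw [IntermediateField.adjoin_le_iff]
      rintro _ ⟨z, rfl⟩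
      refine IntermediateField.subset_adjoin _ _
        ⟨⟨fieldAction ρ g z, hE.1 g z z.2.1, hgB g z z.2.2⟩, ?_⟩
      exact hgψ g z z.2.2
    exact hle hy
  · by_contra hg1
    have h1 := hg (χ ⟨x g, hxE g, hxB g⟩) (IntermediateField.subset_adjoin _ _ ⟨_, rfl⟩)
    rw [hχ, ← hgψ g _ (hxB g), ← sub_eq_zero, ← map_sub] at h1
    rw [hψ' _ _ _ ((hφp' g).2 hg1).2 (hnd (fieldAction ρ g (x g) - x g))] at h1
    exact mul_ne_zero ((hφp' g).2 hg1).1 (inv_ne_zero ((hφp' g).2 hg1).2) h1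
  · have h1 : Algebra.trdeg K (IntermediateField.adjoin K (χ.range : Set L)) ≤
        Algebra.trdeg K χ.range := by
      refine trdeg_le_of_isAlgebraic fun y hy ↦ ?_
      have : IsAlgebraic (IntermediateField.adjoin K (χ.range : Set L)) y :=
        isAlgebraic_algebraMap (⟨y, hy⟩ : IntermediateField.adjoin K (χ.range : Set L))
      rw [IntermediateField.isAlgebraic_adjoin_iff] at this
      rwa [Algebra.adjoin_eq] at this
    have h2 : Algebra.trdeg K χ.range ≤ Algebra.trdeg K A :=
      trdeg_le_of_surjective χ.rangeRestrict χ.rangeRestrict_surjective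
    have h3 : Algebra.trdeg K A ≤ Algebra.trdeg K E :=
      trdeg_le_of_injective (Subalgebra.inclusion (inf_le_left : A ≤ E.toSubalgebra))
        (Subalgebra.inclusion_injective _)
    exact h1.trans (h2.trans h3)

end Versal
end EssDim

namespace EssDim
universe u

/-! ### Residues and residue fields of subfields -/

section Residue

open WithZero MvPolynomial

variable {K F L : Type u} [Field K] [Field F] [Field L] [Algebra K F] [Algebra K L] [Algebra F L]
  [IsScalarTower K F L] (v : Valuation L ℤᵐ⁰)

/-- The element `c` of the coefficient field `F` is the residue of `x`. -/
def HasResidue (x : L) (c : F) : Prop := v (x - algebraMap F L c) < 1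

variable {v}

theorem hasResidue_algebraMap (c : F) : HasResidue v (algebraMap F L c) c := by
  simp [HasResidue]

theorem hasResidue_algebraMap' (c : K) : HasResidue v (algebraMap K L c) (algebraMap K F c) := by
  rw [IsScalarTower.algebraMap_apply K F L]
  exact hasResidue_algebraMap _

theorem HasResidue.add {x y : L} {c d : F} (hx : HasResidue v x c) (hy : HasResidue v y d) :
    HasResidue v (x + y) (c + d) := by
  have : x + y - algebraMap F L (c + d) = (x - algebraMap F L c) + (y - algebraMap F L d) := by
    rw [map_add]; ring
  rw [HasResidue, this]
  exact v.map_add_lt hx hy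

theorem hasResidue_sum {ι : Type*} (s : Finset ι) {x : ι → L} {c : ι → F}
    (h : ∀ i ∈ s, HasResidue v (x i) (c i)) : HasResidue v (∑ i ∈ s, x i) (∑ i ∈ s, c i) := by
  classical
  induction s using Finset.induction_on with
  | empty => simp [HasResidue]
  | insert a s ha ih =>
    rw [Finset.sum_insert ha, Finset.sum_insert ha]
    exact (h a (Finset.mem_insert_self _ _)).add (ih fun i hi ↦ h i (Finset.mem_insert_of_mem hi))

variable (hF : ∀ c : F, c ≠ 0 → v (algebraMap F L c) = 1)
include hF

theorem HasResidue.valuation_eq_one {x : L} {c : F} (hx : HasResidue v x c) (hc : c ≠ 0) :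
    v x = 1 := by
  have := v.map_add_eq_of_lt_right (x := x - algebraMap F L c)
    (y := algebraMap F L c) (by rw [hF c hc]; exact hx)
  rwa [sub_add_cancel, hF c hc] at this

theorem HasResidue.valuation_le_one {x : L} {c : F} (hx : HasResidue v x c) : v x ≤ 1 := by
  by_cases hc : c = 0
  · subst hc
    simpa [HasResidue] using le_of_lt hx
  · exact (hx.valuation_eq_one hF hc).le

theorem valuation_algebraMap_le_one (c : F) : v (algebraMap F L c) ≤ 1 :=
  (hasResidue_algebraMap c).valuation_le_one hF

theorem HasResidue.mul {x y : L} {c d : F} (hx : HasResidue v x c) (hy : HasResidue v y d) :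
    HasResidue v (x * y) (c * d) := by
  have : x * y - algebraMap F L (c * d) =
      x * (y - algebraMap F L d) + (x - algebraMap F L c) * algebraMap F L d := by
    rw [map_mul]; ring
  rw [HasResidue, this]
  refine v.map_add_lt ?_ ?_
  · rw [map_mul]
    exact (mul_le_of_le_one_left' (hx.valuation_le_one hF)).trans_lt hy
  · rw [map_mul]
    exact (mul_le_of_le_one_right' (valuation_algebraMap_le_one hF d)).trans_lt hx

theorem HasResidue.eq {x : L} {c d : F} (hx : HasResidue v x c) (hy : HasResidue v x d) :
    c = d := by
  by_contra h
  have h1 := hF (c - d) (sub_ne_zero.2 h)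
  have h2 : algebraMap F L (c - d) = (x - algebraMap F L d) - (x - algebraMap F L c) := by
    rw [map_sub]; ring
  rw [h2] at h1
  exact (v.map_sub_lt hy hx).ne h1

omit hF in
theorem HasResidue.ne_zero {x : L} {c : F} (hx : HasResidue v x c) (h : v x = 1) : c ≠ 0 := by
  rintro rfl
  rw [HasResidue, map_zero, sub_zero, h] at hx
  exact lt_irrefl _ hx

theorem HasResidue.inv {x : L} {c : F} (hx : HasResidue v x c) (hc : c ≠ 0) :
    HasResidue v x⁻¹ c⁻¹ := by
  have h1 := hx.valuation_eq_one hF hc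
  have hx0 : x ≠ 0 := fun h ↦ by simp [h] at h1
  have hc0 : algebraMap F L c ≠ 0 := by simpa using hc
  have : x⁻¹ - algebraMap F L c⁻¹ =
      -(x - algebraMap F L c) * (x⁻¹ * (algebraMap F L c)⁻¹) := by
    rw [map_inv₀]; field_simp; ring
  rw [HasResidue, this, map_mul, map_mul, map_inv₀, map_inv₀, h1, hF c hc, Valuation.map_neg]
  simpa [HasResidue] using hx

theorem HasResidue.pow {x : L} {c : F} (hx : HasResidue v x c) (n : ℕ) :
    HasResidue v (x ^ n) (c ^ n) := by
  induction n with
  | zero => simp [HasResidue]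
  | succ n ih => rw [pow_succ, pow_succ]; exact ih.mul hF hx

theorem HasResidue.zpow {x : L} {c : F} (hx : HasResidue v x c) (hc : c ≠ 0) (n : ℤ) :
    HasResidue v (x ^ n) (c ^ n) := by
  cases n with
  | ofNat n => simpa using hx.pow hF n
  | negSucc n =>
    rw [zpow_negSucc, zpow_negSucc]
    exact (hx.pow hF _).inv hF (pow_ne_zero _ hc)

theorem hasResidue_aeval {ι : Type*} {x : ι → L} {c : ι → F} (h : ∀ i, HasResidue v (x i) (c i))
    (p : MvPolynomial ι K) : HasResidue v (aeval x p) (aeval c p) := by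
  induction p using MvPolynomial.induction_on with
  | C a => rw [algHom_C, algHom_C]; exact hasResidue_algebraMap' a
  | add p q hp hq => rw [map_add, map_add]; exact hp.add hq
  | mul_X p i hp => rw [map_mul, map_mul, aeval_X, aeval_X]; exact hp.mul hF (h i)

/-- The residue field of a subfield `E` of `L`, as a subfield of the coefficient field `F`. -/
def residueSubfield (E : IntermediateField K L) : IntermediateField K F where
  carrier := {c | ∃ x ∈ E, HasResidue v x c}
  mul_mem' := fun ⟨x, hx, hc⟩ ⟨y, hy, hd⟩ ↦ ⟨x * y, mul_mem hx hy, hc.mul hF hd⟩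
  add_mem' := fun ⟨x, hx, hc⟩ ⟨y, hy, hd⟩ ↦ ⟨x + y, add_mem hx hy, hc.add hd⟩
  algebraMap_mem' := fun a ↦ ⟨_, E.algebraMap_mem a, hasResidue_algebraMap' a⟩
  inv_mem' := fun c ⟨x, hx, hc⟩ ↦ by
    by_cases h : c = 0
    · subst h
      exact ⟨x, hx, by simpa using hc⟩
    · exact ⟨x⁻¹, inv_mem hx, hc.inv hF h⟩

/-- Lift a transcendence basis of the residue field to `E`. Nonzero polynomials in the lifts have
nonzero residue, so `v` is trivial on the algebra they generate. An algebraic relation for `π` over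
it, with nonzero constant term, is impossible because that term dominates. -/
theorem trdeg_residueSubfield_add_one_le {E : IntermediateField K L} {π : L} (hπ : π ∈ E)
    (hπ0 : π ≠ 0) (hπv : v π < 1) :
    Algebra.trdeg K (residueSubfield hF E) + 1 ≤ Algebra.trdeg K E := by
  obtain ⟨ι, c, hc⟩ := exists_isTranscendenceBasis' K (residueSubfield hF E)
  have hc' : ∀ i, ∃ x ∈ E, HasResidue v x (c i : F) := fun i ↦ (c i).2
  choose x hx hxc using hc'
  have hcF : AlgebraicIndependent K fun i ↦ (c i : F) :=
    hc.1.map' (f := (residueSubfield hF E).val) Subtype.val_injective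
  have hval : ∀ p : MvPolynomial ι K, p ≠ 0 → v (aeval x p) = 1 := fun p hp ↦
    (hasResidue_aeval hF hxc p).valuation_eq_one hF fun h ↦
      hp ((injective_iff_map_eq_zero _).1 hcF p h)
  have hxi : AlgebraicIndependent K x := (injective_iff_map_eq_zero _).2 fun p hp ↦ by
    by_contra h
    have := hval p h
    rw [hp, map_zero] at this
    exact zero_ne_one this
  have hadj : ∀ z : Algebra.adjoin K (Set.range x), z ≠ 0 → v (z : L) = 1 := fun z hz ↦ by
    have hz' : (z : L) ∈ (aeval x : MvPolynomial ι K →ₐ[K] L).range :=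
      Algebra.adjoin_range_eq_range_aeval K x ▸ z.2
    obtain ⟨p, hp⟩ := hz'
    have hp' : aeval x p = (z : L) := hp
    rw [← hp']
    refine hval p ?_
    rintro rfl
    exact hz (Subtype.ext (by rw [← hp', map_zero]; rfl))
  have hadj' : ∀ z : Algebra.adjoin K (Set.range x), v (z : L) ≤ 1 := fun z ↦ by
    by_cases hz : z = 0
    · simp [hz]
    · exact (hadj z hz).le
  have htr : Transcendental (Algebra.adjoin K (Set.range x)) π := fun halg ↦ by
    obtain ⟨q, hq0, hq⟩ :=
      halg.exists_nonzero_coeff_and_aeval_eq_zero (mem_nonZeroDivisors_of_ne_zero hπ0)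
    rw [← q.divX_mul_X_add, map_add, map_mul, Polynomial.aeval_X, Polynomial.aeval_C] at hq
    have h1 : v (Polynomial.aeval π q.divX) ≤ 1 := by
      rw [Polynomial.aeval_eq_sum_range]
      refine v.map_sum_le fun i _ ↦ ?_
      rw [Algebra.smul_def, map_mul, map_pow]
      exact mul_le_one' (hadj' _) (pow_le_one' hπv.le _)
    have h2 : v (Polynomial.aeval π q.divX * π) < 1 := by
      rw [map_mul]
      exact (mul_le_of_le_one_left' h1).trans_lt hπv
    rw [eq_neg_of_add_eq_zero_left hq, Valuation.map_neg] at h2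
    exact h2.ne (hadj _ hq0)
  have hopt := (hxi.option_iff_transcendental π).2 htr
  have hE : AlgebraicIndependent K (fun o : Option ι ↦
      (⟨o.elim π x, by cases o with
        | none => exact hπ
        | some i => exact hx i⟩ : E)) :=
    hopt.of_comp E.val
  rw [← hc.cardinalMk_eq_trdeg, ← Cardinal.mk_option]
  exact hE.cardinalMk_le_trdeg

-- The exponents of values on `E` form a nonzero subgroup of `ℤ`, which is cyclic; `π` realizes its
-- negative generator.
omit hF in
theorem exists_uniformizer {E : IntermediateField K L} (h : ∃ x ∈ E, x ≠ 0 ∧ v x ≠ 1) :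
    ∃ π ∈ E, π ≠ 0 ∧ v π < 1 ∧ ∀ y ∈ E, y ≠ 0 → ∃ k : ℤ, v y = v π ^ k := by
  let S : AddSubgroup ℤ :=
    { carrier := {k | ∃ y ∈ E, y ≠ 0 ∧ v y = exp k}
      zero_mem' := ⟨1, one_mem _, one_ne_zero, by simp⟩
      add_mem' := fun {a b} ⟨x, hx, hx0, hxa⟩ ⟨y, hy, hy0, hyb⟩ ↦
        ⟨x * y, mul_mem hx hy, mul_ne_zero hx0 hy0, by rw [map_mul, hxa, hyb, exp_add]⟩
      neg_mem' := fun {a} ⟨x, hx, hx0, hxa⟩ ↦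
        ⟨x⁻¹, inv_mem hx, inv_ne_zero hx0, by rw [map_inv₀, hxa, exp_neg]⟩ }
  have hlog : ∀ y : L, y ≠ 0 → v y = exp (log (v y)) := fun y hy ↦
    (exp_log ((Valuation.ne_zero_iff v).2 hy)).symm
  obtain ⟨a, ha⟩ := Int.subgroup_cyclic S
  have haS : a ∈ S := ha ▸ AddSubgroup.subset_closure rfl
  have hgen : ∀ b, (b = a ∨ b = -a) → ∀ k ∈ S, ∃ n : ℤ, k = n * b := by
    intro b hb k hk
    rw [ha, AddSubgroup.mem_closure_singleton] at hk
    obtain ⟨n, rfl⟩ := hk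
    rcases hb with rfl | rfl
    · exact ⟨n, by simp⟩
    · exact ⟨-n, by simp⟩
  have ha0 : a ≠ 0 := by
    rintro rfl
    obtain ⟨x, hx, hx0, hx1⟩ := h
    obtain ⟨n, hn⟩ := hgen 0 (Or.inl rfl) _ (show log (v x) ∈ S from ⟨x, hx, hx0, hlog x hx0⟩)
    rw [mul_zero] at hn
    rw [hlog x hx0, hn] at hx1
    simp at hx1
  obtain ⟨b, hb, hbS, hb0⟩ : ∃ b, (b = a ∨ b = -a) ∧ b ∈ S ∧ b < 0 := by
    rcases lt_or_gt_of_ne ha0 with h | h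
    · exact ⟨a, Or.inl rfl, haS, h⟩
    · exact ⟨-a, Or.inr rfl, neg_mem haS, by omega⟩
  obtain ⟨π, hπ, hπ0, hπb⟩ := hbS
  refine ⟨π, hπ, hπ0, ?_, fun y hy hy0 ↦ ?_⟩
  · rw [hπb, ← exp_zero, exp_lt_exp]
    exact hb0
  · obtain ⟨n, hn⟩ := hgen b hb _ (show log (v y) ∈ S from ⟨y, hy, hy0, hlog y hy0⟩)
    refine ⟨n, ?_⟩
    rw [hlog y hy0, hn, hπb, ← exp_zsmul, smul_eq_mul]

end Residue
end EssDim

namespace EssDim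
universe u

/-! ### Inertia and the tame character -/

section Inertia

open WithZero

variable {K F L : Type u} [Field K] [Field F] [Field L] [Algebra K F] [Algebra K L] [Algebra F L]
  [IsScalarTower K F L] {v : Valuation L ℤᵐ⁰} (hF : ∀ c : F, c ≠ 0 → v (algebraMap F L c) = 1)
  (hres : ∀ x : L, v x ≤ 1 → ∃ c : F, HasResidue v x c)
  {G : Type*} [Group G] {α : G →* (L ≃ₐ[K] L)} {β : G →* (F ≃ₐ[K] F)}
  (hv : ∀ g x, v (α g x) = v x)
  (hαβ : ∀ g c, α g (algebraMap F L c) = algebraMap F L (β g c))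
  {E : IntermediateField K L}

omit [IsScalarTower K F L] in
include hv hαβ in
theorem HasResidue.map {x : L} {c : F} (h : HasResidue v x c) (g : G) :
    HasResidue v (α g x) (β g c) := by
  rw [HasResidue, ← hαβ, ← map_sub, hv]
  exact h

include hv hαβ in
theorem residueSubfield_stable (hE : ∀ g, ∀ x ∈ E, α g x ∈ E) (g : G) {c : F}
    (hc : c ∈ residueSubfield hF E) : β g c ∈ residueSubfield hF E := by
  obtain ⟨x, hx, hxc⟩ := hc
  exact ⟨α g x, hE g x hx, hxc.map hv hαβ g⟩

omit [IsScalarTower K F L] in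
include hres hv hαβ in
/-- A valuation whose inertia group is nontrivial cannot become trivial on a subfield with a
faithful action. -/
theorem exists_valuation_ne_one (hE : IsStableFaithful α E) {τ : G} (hτ : τ ≠ 1)
    (hβτ : β τ = 1) : ∃ x ∈ E, x ≠ 0 ∧ v x ≠ 1 := by
  by_contra! hcon
  refine hτ (hE.2 τ fun y hy ↦ ?_)
  by_contra hne
  have hz := hcon (α τ y - y) (sub_mem (hE.1 τ y hy) hy) (sub_ne_zero.2 hne)
  have hy1 : v y ≤ 1 := by
    by_cases h0 : y = 0
    · simp [h0]
    · exact (hcon y hy h0).le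
  obtain ⟨c, hc⟩ := hres y hy1
  have h1 := hc.map hv hαβ τ
  rw [hβτ, AlgEquiv.one_apply] at h1
  have : α τ y - y = (α τ y - algebraMap F L c) - (y - algebraMap F L c) := by ring
  rw [this] at hz
  exact (v.map_sub_lt h1 hc).ne hz

variable {π : L} (hπ : π ∈ E) (hπ0 : π ≠ 0)

omit [IsScalarTower K F L] in
include hF hv hαβ in
/-- Multiplicativity of the tame character on the inertia group. -/
theorem hasResidue_mul_div {g h : G} {a b : F} (ha : HasResidue v (α g π / π) a)
    (hb : HasResidue v (α h π / π) b) (hgb : β g b = b) (hπ0 : π ≠ 0) :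
    HasResidue v (α (g * h) π / π) (a * b) := by
  have h1 := hb.map hv hαβ g
  rw [hgb] at h1
  have h2 : α (g * h) π / π = α g π / π * α g (α h π / π) := by
    have : α g π ≠ 0 := by simpa using hπ0
    rw [map_mul, AlgEquiv.mul_apply, map_div₀]
    field_simp
  rw [h2]
  exact ha.mul hF h1

omit [IsScalarTower K F L] in
include hF hv hαβ in
theorem hasResidue_pow_div {g : G} {a : F} (ha : HasResidue v (α g π / π) a) (hga : β g a = a)
    (hπ0 : π ≠ 0) (n : ℕ) : HasResidue v (α (g ^ n) π / π) (a ^ n) := by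
  induction n with
  | zero => simp [HasResidue, div_self hπ0]
  | succ n ih =>
    rw [pow_succ', pow_succ']
    refine hasResidue_mul_div hF hv hαβ ha ih ?_ hπ0
    rw [map_pow, hga]

omit [Algebra K F] [IsScalarTower K F L] in
include hv hres in
theorem exists_hasResidue_div (hπ0 : π ≠ 0) (g : G) : ∃ a : F, a ≠ 0 ∧ HasResidue v (α g π / π) a := by
  have h1 : v (α g π / π) = 1 := by
    rw [map_div₀, hv, div_self ((Valuation.ne_zero_iff v).2 hπ0)]
  obtain ⟨a, ha⟩ := hres _ h1.le
  exact ⟨a, ha.ne_zero h1, ha⟩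

variable (huni : ∀ y ∈ E, y ≠ 0 → ∃ k : ℤ, v y = v π ^ k)
  (hE : ∀ g, ∀ x ∈ E, α g x ∈ E)

include hF hres hv hαβ hπ hπ0 huni hE in
/-- An element of the inertia group of order prime to the characteristic and with trivial tame
character acts trivially. -/
theorem apply_eq_of_hasResidue_one {g : G} (hg : ∀ c ∈ residueSubfield hF E, β g c = c)
    (hgπ : HasResidue v (α g π / π) (1 : F)) {n : ℕ} (hn : (n : K) ≠ 0) (hgn : g ^ n = 1) {y : L}
    (hy : y ∈ E) : α g y = y := by
  -- Write `y` as a unit times a power of `π`: `g` fixes the residue of the unit and multiplies `π`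
  -- by an element of residue one.
  have h1 : ∀ y ∈ E, y ≠ 0 → HasResidue v (α g y / y) (1 : F) := fun y hy hy0 ↦ by
    obtain ⟨k, hk⟩ := huni y hy hy0
    have hvπ : v π ≠ 0 := (Valuation.ne_zero_iff v).2 hπ0
    have hu1 : v (y * π ^ (-k)) = 1 := by
      rw [map_mul, hk, map_zpow₀, ← zpow_add₀ hvπ, add_neg_cancel, zpow_zero]
    have huE : y * π ^ (-k) ∈ E := mul_mem hy (zpow_mem hπ _)
    obtain ⟨c, hc⟩ := hres _ hu1.le
    have hc0 := hc.ne_zero hu1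
    have hc' := hc.map hv hαβ g
    rw [hg c ⟨_, huE, hc⟩] at hc'
    have h2 := (hgπ.zpow hF one_ne_zero k).mul hF (hc'.mul hF (hc.inv hF hc0))
    rw [one_zpow, one_mul, mul_inv_cancel₀ hc0] at h2
    have hgπ0 : α g π ≠ 0 := by simpa using hπ0
    convert h2 using 1
    rw [map_mul, map_zpow₀, div_zpow, zpow_neg, zpow_neg, mul_inv, inv_inv]
    have := zpow_ne_zero k hπ0
    have := zpow_ne_zero k hgπ0
    field_simp
  by_contra hne
  have hz0 : α g y - y ≠ 0 := sub_ne_zero.2 hne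
  have hzE : α g y - y ∈ E := sub_mem (hE g y hy) hy
  set z := α g y - y with hz
  have h3 : ∀ k : ℕ, HasResidue v (α (g ^ k) z / z) (1 : F) := fun k ↦ by
    induction k with
    | zero => simp [HasResidue, div_self hz0]
    | succ k ih =>
      have hw0 : α (g ^ k) z ≠ 0 := (map_ne_zero _).2 hz0
      have h4 := (h1 _ (hE (g ^ k) z hzE) hw0).mul hF ih
      rw [one_mul, div_mul_div_cancel₀ hw0, ← AlgEquiv.mul_apply, ← map_mul, ← pow_succ'] at h4
      exact h4
  -- The sum of the `g ^ k z` telescopes to `g ^ n y - y = 0`, but each term divided by `z` has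
  -- residue one, so the quotient sum has residue `n ≠ 0`.
  have h5 := hasResidue_sum (Finset.range n) fun k _ ↦ h3 k
  have h6 : ∑ k ∈ Finset.range n, α (g ^ k) z / z = 0 := by
    rw [← Finset.sum_div]
    have : ∀ k, α (g ^ k) z = α (g ^ (k + 1)) y - α (g ^ k) y := fun k ↦ by
      rw [hz, map_sub, ← AlgEquiv.mul_apply, ← map_mul, ← pow_succ]
    simp only [this]
    rw [Finset.sum_range_sub (fun k ↦ α (g ^ k) y), hgn]
    simp
  rw [h6, Finset.sum_const, Finset.card_range, nsmul_eq_mul, mul_one] at h5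
  have h7 := h5.valuation_eq_one hF (by
    intro h0
    apply hn
    apply (algebraMap K F).injective
    rw [map_natCast, h0, map_zero])
  simp at h7

include hres hv hαβ in
/-- If an element of prime order different from the characteristic acts trivially on residues, then
passing to the residue field of a stable subfield lowers the transcendence degree, and enlarges
the kernel of the action, among the commuting elements of the same order, only by its powers. -/
theorem residueSubfield_of_tame (hE : IsStableFaithful α E) {τ : G} (hτ : τ ≠ 1) (hβτ : β τ = 1)
    {ℓ : ℕ} (hℓ : ℓ.Prime) (hℓK : (ℓ : K) ≠ 0) (hτℓ : τ ^ ℓ = 1) :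
    Algebra.trdeg K (residueSubfield hF E) + 1 ≤ Algebra.trdeg K E ∧
      ∀ g : G, Commute g τ → g ^ ℓ = 1 → (∀ c ∈ residueSubfield hF E, β g c = c) →
        g ∈ Subgroup.zpowers τ := by
  obtain ⟨π, hπ, hπ0, hπ1, huni⟩ := exists_uniformizer
    (exists_valuation_ne_one hres hv hαβ hE hτ hβτ)
  refine ⟨trdeg_residueSubfield_add_one_le hF hπ hπ0 hπ1, fun g hgτ hgℓ hg ↦ ?_⟩
  have hmem : ∀ h a, HasResidue v (α h π / π) a → a ∈ residueSubfield hF E :=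
    fun h a ha ↦ ⟨_, div_mem (hE.1 h π hπ) hπ, ha⟩
  have hβτ' : ∀ c, β τ c = c := fun c ↦ by rw [hβτ, AlgEquiv.one_apply]
  obtain ⟨a, ha0, ha⟩ := exists_hasResidue_div hres hv hπ0 g
  obtain ⟨b, hb0, hb⟩ := exists_hasResidue_div hres hv hπ0 τ
  have hpow : ∀ h c, HasResidue v (α h π / π) c → β h c = c → h ^ ℓ = 1 → c ^ ℓ = 1 :=
    fun h c hc hhc hhℓ ↦ by
      have h1 := hasResidue_pow_div hF hv hαβ hc hhc hπ0 ℓ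
      rw [hhℓ, map_one, AlgEquiv.one_apply, div_self hπ0] at h1
      have h2 : HasResidue v (1 : L) (1 : F) := by simp [HasResidue]
      exact h1.eq hF h2
  have haℓ := hpow g a ha (hg a (hmem g a ha)) hgℓ
  have hbℓ := hpow τ b hb (hβτ' b) hτℓ
  -- A trivial tame character would make `τ` act trivially on `E`. Hence `b` is a primitive `ℓ`-th
  -- root of unity and `a` is a power of it.
  have hb1 : b ≠ 1 := by
    rintro rfl
    exact hτ (hE.2 τ fun y hy ↦ apply_eq_of_hasResidue_one hF hres hv hαβ hπ hπ0 huni hE.1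
      (fun c _ ↦ hβτ' c) hb hℓK hτℓ hy)
  have : Fact ℓ.Prime := ⟨hℓ⟩
  have hprim : IsPrimitiveRoot b ℓ := orderOf_eq_prime hbℓ hb1 ▸ IsPrimitiveRoot.orderOf b
  obtain ⟨i, -, hi⟩ := hprim.eq_pow_of_pow_eq_one haℓ
  have : NeZero ℓ := ⟨hℓ.ne_zero⟩
  -- Modulo `ℓ` the exponent is `-i`, so this element is `g τ⁻ⁱ`, chosen to have trivial tame
  -- character.
  have h1 : HasResidue v (α (g * τ ^ (i * (ℓ - 1))) π / π) (1 : F) := by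
    have h2 := hasResidue_mul_div hF hv hαβ ha
      (hasResidue_pow_div hF hv hαβ hb (hβτ' b) hπ0 (i * (ℓ - 1)))
      (hg _ (hmem _ _ (hasResidue_pow_div hF hv hαβ hb (hβτ' b) hπ0 _))) hπ0
    have h3 : a * b ^ (i * (ℓ - 1)) = 1 := by
      rw [← hi, ← pow_add]
      have : i + i * (ℓ - 1) = ℓ * i := by
        obtain ⟨k, rfl⟩ := Nat.exists_eq_succ_of_ne_zero hℓ.ne_zero
        simp only [Nat.succ_eq_add_one, Nat.add_sub_cancel]
        ring
      rw [this, pow_mul, hbℓ, one_pow]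
    rwa [h3] at h2
  have h4 : g * τ ^ (i * (ℓ - 1)) = 1 := by
    refine hE.2 _ fun y hy ↦ apply_eq_of_hasResidue_one hF hres hv hαβ hπ hπ0 huni hE.1
      (fun c hc ↦ ?_) h1 hℓK ?_ hy
    · rw [map_mul, AlgEquiv.mul_apply, map_pow, hβτ, one_pow, AlgEquiv.one_apply, hg c hc]
    · rw [(hgτ.pow_right _).mul_pow, hgℓ, one_mul, ← pow_mul, mul_comm, pow_mul, hτℓ, one_pow]
  rw [eq_inv_of_mul_eq_one_left h4]
  exact inv_mem (pow_mem (Subgroup.mem_zpowers τ) _)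

include hres hv hαβ in
/-- If a group acts trivially on the residue field of a stable faithful subfield, then an element
of prime order different from the characteristic is not conjugate to its inverse, unless this order
is two. -/
theorem eq_one_of_residueSubfield_fixed (hE : IsStableFaithful α E) {τ : G} (hτ : τ ≠ 1)
    (hβτ : β τ = 1) (hfix : ∀ g, ∀ c ∈ residueSubfield hF E, β g c = c) {n : ℕ} (hn : Odd n)
    (hnK : (n : K) ≠ 0) {g h : G} (hg : g ^ n = 1) (hgh : h * g = g⁻¹ * h) : g = 1 := by
  obtain ⟨π, hπ, hπ0, hπ1, huni⟩ := exists_uniformizer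
    (exists_valuation_ne_one hres hv hαβ hE hτ hβτ)
  have hmem : ∀ h a, HasResidue v (α h π / π) a → a ∈ residueSubfield hF E :=
    fun h a ha ↦ ⟨_, div_mem (hE.1 h π hπ) hπ, ha⟩
  have hmul : ∀ {g h : G} {a b : F}, HasResidue v (α g π / π) a → HasResidue v (α h π / π) b →
      HasResidue v (α (g * h) π / π) (a * b) := fun {g h a b} ha hb ↦
    hasResidue_mul_div hF hv hαβ ha hb (hfix g b (hmem h b hb)) hπ0
  obtain ⟨a, ha0, ha⟩ := exists_hasResidue_div hres hv hπ0 g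
  obtain ⟨a', -, ha'⟩ := exists_hasResidue_div hres hv hπ0 g⁻¹
  obtain ⟨b, hb0, hb⟩ := exists_hasResidue_div hres hv hπ0 h
  have hone : HasResidue v (α (1 : G) π / π) (1 : F) := by simp [HasResidue, div_self hπ0]
  have h1 : a * a' = 1 := (mul_inv_cancel g ▸ hmul ha ha').eq hF hone
  -- The character is multiplicative on the whole group with commutative values, so `h g h⁻¹ = g⁻¹`
  -- forces `a = a⁻¹`; odd `n` then gives `a = 1`.
  have h2 : b * a = a' * b := (hgh ▸ hmul hb ha).eq hF (hmul ha' hb)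
  have h3 : a ^ 2 = 1 := by
    have : a = a' := mul_left_cancel₀ hb0 (by rw [h2, mul_comm])
    rw [sq]
    nth_rewrite 2 [this]
    exact h1
  have h4 : a ^ n = 1 :=
    (hasResidue_pow_div hF hv hαβ ha (hfix g a (hmem g a ha)) hπ0 n).eq hF (by rwa [hg])
  have h5 : a = 1 := by
    obtain ⟨k, rfl⟩ := hn
    rwa [pow_succ, pow_mul, h3, one_pow, one_mul] at h4
  subst h5
  exact hE.2 g fun y hy ↦ apply_eq_of_hasResidue_one hF hres hv hαβ hπ hπ0 huni hE.1
    (hfix g) ha hnK hg hy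

end Inertia
end EssDim

namespace EssDim
universe u

/-! ### Actions on `F(t)` and the valuation at infinity -/

section RationalFunctions

open WithZero Polynomial

variable {K F : Type u} [Field K] [Field F] [Algebra K F]

/-- Extension of an automorphism of `F[t]` to `F(t)`. -/
noncomputable def ratFuncLift : (F[X] ≃ₐ[K] F[X]) →* (RatFunc F ≃ₐ[K] RatFunc F) :=
  IsFractionRing.fieldEquivOfAlgEquivHom K (RatFunc F)

theorem ratFuncLift_algebraMap (σ : F[X] ≃ₐ[K] F[X]) (p : F[X]) :
    ratFuncLift σ (algebraMap F[X] (RatFunc F) p) = algebraMap _ _ (σ p) := by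
  simp [ratFuncLift]

theorem ratFuncLift_C (σ : F[X] ≃ₐ[K] F[X]) {c d : F} (h : σ (C c) = C d) :
    ratFuncLift σ (algebraMap F (RatFunc F) c) = algebraMap F (RatFunc F) d := by
  rw [IsScalarTower.algebraMap_apply F F[X] (RatFunc F), ratFuncLift_algebraMap,
    Polynomial.algebraMap_eq, h, ← Polynomial.algebraMap_eq, ← IsScalarTower.algebraMap_apply]

theorem ratFuncLift_injective :
    Function.Injective (ratFuncLift : (F[X] ≃ₐ[K] F[X]) →* (RatFunc F ≃ₐ[K] RatFunc F)) :=
  IsFractionRing.fieldEquivOfAlgEquivHom_injective K F[X] K (RatFunc F)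

open Classical in
/-- The valuation at infinity is preserved by automorphisms of `F[t]` preserving the degree. -/
theorem inftyValuation_ratFuncLift {σ : F[X] ≃ₐ[K] F[X]} (hσ : ∀ p, (σ p).natDegree = p.natDegree)
    (x : RatFunc F) : RatFunc.inftyValuation F (ratFuncLift σ x) = RatFunc.inftyValuation F x := by
  obtain ⟨p, q, hq, rfl⟩ := IsFractionRing.div_surjective (A := F[X]) x
  have key : ∀ p : F[X], RatFunc.inftyValuation F (algebraMap F[X] (RatFunc F) (σ p)) =
      RatFunc.inftyValuation F (algebraMap F[X] (RatFunc F) p) := fun p ↦ by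
    by_cases hp : p = 0
    · simp [hp]
    · rw [RatFunc.inftyValuation_apply, RatFunc.inftyValuation_apply,
        RatFunc.inftyValuation.polynomial _ hp, RatFunc.inftyValuation.polynomial _ (by simpa), hσ]
  rw [map_div₀, map_div₀, map_div₀, ratFuncLift_algebraMap, ratFuncLift_algebraMap, key, key]

open Classical in
theorem inftyValuation_algebraMap {c : F} (hc : c ≠ 0) :
    RatFunc.inftyValuation F (algebraMap F (RatFunc F) c) = 1 := by
  rw [RatFunc.algebraMap_eq_C]
  exact RatFunc.inftyValuation.C F hc

open Classical in
theorem exists_hasResidue_inftyValuation {x : RatFunc F} (hx : RatFunc.inftyValuation F x ≤ 1) :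
    ∃ c : F, HasResidue (RatFunc.inftyValuation F) x c := by
  obtain ⟨p, q, hq, rfl⟩ := IsFractionRing.div_surjective (A := F[X]) x
  have hq0 : q ≠ 0 := nonZeroDivisors.ne_zero hq
  have hval : ∀ p : F[X], p ≠ 0 → RatFunc.inftyValuation F (algebraMap F[X] (RatFunc F) p) =
      exp (p.natDegree : ℤ) := fun p hp ↦ RatFunc.inftyValuation.polynomial _ hp
  have hlq : q.leadingCoeff ≠ 0 := leadingCoeff_ne_zero.2 hq0
  have hpq : p.natDegree ≤ q.natDegree := by
    by_cases hp : p = 0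
    · simp [hp]
    rw [map_div₀, hval p hp, hval q hq0, ← exp_sub, ← exp_zero, exp_le_exp] at hx
    omega
  -- The value at infinity; the coefficient is taken in degree `deg q`, so it is zero when `deg p <
  -- deg q`.
  refine ⟨p.coeff q.natDegree / q.leadingCoeff, ?_⟩
  set c := p.coeff q.natDegree / q.leadingCoeff with hc
  have h1 : algebraMap F[X] (RatFunc F) p / algebraMap F[X] (RatFunc F) q -
      algebraMap F (RatFunc F) c =
      algebraMap F[X] (RatFunc F) (p - C c * q) / algebraMap F[X] (RatFunc F) q := by
    have : algebraMap F[X] (RatFunc F) q ≠ 0 := by simpa using hq0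
    rw [IsScalarTower.algebraMap_apply F F[X] (RatFunc F), Polynomial.algebraMap_eq, map_sub,
      map_mul, sub_div, mul_div_cancel_right₀ _ this]
  rw [HasResidue, h1]
  by_cases hr : p - C c * q = 0
  · simp [hr]
  rw [map_div₀, hval _ hr, hval q hq0, ← exp_sub, ← exp_zero, exp_lt_exp]
  have h2 : (p - C c * q).natDegree ≤ q.natDegree :=
    (natDegree_sub_le _ _).trans (max_le hpq (natDegree_C_mul_le _ _))
  have h3 : (p - C c * q).natDegree ≠ q.natDegree := fun h ↦ by
    have : (p - C c * q).leadingCoeff = 0 := by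
      rw [leadingCoeff, h, coeff_sub, coeff_C_mul, hc]
      change _ - _ * q.leadingCoeff = 0
      rw [div_mul_cancel₀ _ hlq, sub_self]
    exact hr (leadingCoeff_eq_zero.1 this)
  omega

/-- The action on `F(t)` through the coefficients. -/
noncomputable def coeffAction : (F ≃ₐ[K] F) →* (F[X] ≃ₐ[K] F[X]) where
  toFun := mapAlgEquiv
  map_one' := mapAlgEquiv_id
  map_mul' f g := by
    ext p : 1
    simp [Polynomial.map_map]
    rfl

variable (F) in
/-- The affine substitution `t ↦ a t + b` on `F[t]`. -/
noncomputable def affineSubst (a b : K) (ha : a ≠ 0) : F[X] ≃ₐ[K] F[X] :=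
  letI := invertibleOfNonzero ((map_ne_zero (algebraMap K F)).2 ha)
  (algEquivCMulXAddC (algebraMap K F a) (algebraMap K F b)).restrictScalars K

theorem affineSubst_apply (a b : K) (ha : a ≠ 0) (p : F[X]) :
    affineSubst F a b ha p = p.comp (C (algebraMap K F a) * X + C (algebraMap K F b)) := by
  simp [affineSubst, algEquivCMulXAddC, comp_eq_aeval]

theorem natDegree_affineSubst (a b : K) (ha : a ≠ 0) (p : F[X]) :
    (affineSubst F a b ha p).natDegree = p.natDegree := by
  rw [affineSubst_apply, natDegree_comp, natDegree_linear ((map_ne_zero (algebraMap K F)).2 ha),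
    mul_one]

theorem commute_coeffAction_affineSubst (f : F ≃ₐ[K] F) (a b : K) (ha : a ≠ 0) :
    Commute (coeffAction f) (affineSubst F a b ha) := by
  ext p : 1
  have : ∀ p, coeffAction f p = p.map (f : F →+* F) := fun _ ↦ rfl
  rw [AlgEquiv.mul_apply, AlgEquiv.mul_apply, affineSubst_apply, affineSubst_apply, this, this,
    Polynomial.map_comp]
  simp

open Classical in
/-- An action on a field `F` together with an affine substitution of finite order defines an action
of a direct product on `F(t)`. -/
theorem exists_action_ratFunc {H : Type*} [Group H] {β : H →* (F ≃ₐ[K] F)}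
    (hβ : Function.Injective β) {a b : K} (ha : a ≠ 0) (hab : affineSubst F a b ha ≠ 1) {ℓ : ℕ}
    (hℓ : ℓ.Prime) (habℓ : affineSubst F a b ha ^ ℓ = 1) :
    ∃ (C : Type u) (_ : Group C) (α : H × C →* (RatFunc F ≃ₐ[K] RatFunc F)) (τ : C),
      Nat.card C = ℓ ∧ τ ≠ 1 ∧ τ ^ ℓ = 1 ∧ Function.Injective α ∧
      (∀ g x, RatFunc.inftyValuation F (α g x) = RatFunc.inftyValuation F x) ∧
      ∀ g c, α g (algebraMap F (RatFunc F) c) = algebraMap F (RatFunc F) (β g.1 c) := by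
  set σ := affineSubst F a b ha with hσ
  have hord : orderOf σ = ℓ := by
    have : Fact ℓ.Prime := ⟨hℓ⟩
    exact orderOf_eq_prime habℓ hab
  let f : H →* (F[X] ≃ₐ[K] F[X]) := coeffAction.comp β
  let γ : H × Subgroup.zpowers σ →* (F[X] ≃ₐ[K] F[X]) :=
    f.noncommCoprod (Subgroup.zpowers σ).subtype (by
      rintro h ⟨_, k, rfl⟩
      exact (commute_coeffAction_affineSubst (β h) a b ha).zpow_right k)
  have hγ : ∀ g : H × Subgroup.zpowers σ, γ g = f g.1 * (g.2 : F[X] ≃ₐ[K] F[X]) := fun g ↦ rfl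
  have hC : ∀ τ : Subgroup.zpowers σ, ∀ c, (τ : F[X] ≃ₐ[K] F[X]) (C c) = C c := by
    intro τ c
    have h1 : Subgroup.zpowers σ ≤ MulAction.stabilizer (F[X] ≃ₐ[K] F[X]) (C c : F[X]) := by
      rw [Subgroup.zpowers_le, MulAction.mem_stabilizer_iff]
      change σ (C c) = C c
      rw [hσ, affineSubst_apply, C_comp]
    exact h1 τ.2
  have hfC : ∀ h c, f h (C c) = C (β h c) := fun h c ↦ Polynomial.map_C _
  have hγC : ∀ g c, γ g (C c) = C (β g.1 c) := fun g c ↦ by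
    rw [hγ, AlgEquiv.mul_apply, hC, hfC]
  have hdegσ : ∀ τ : Subgroup.zpowers σ, ∀ p, ((τ : F[X] ≃ₐ[K] F[X]) p).natDegree = p.natDegree := by
    let D : Subgroup (F[X] ≃ₐ[K] F[X]) :=
      { carrier := {τ | ∀ p, (τ p).natDegree = p.natDegree}
        mul_mem' := fun {x y} hx hy p ↦ by rw [AlgEquiv.mul_apply, hx, hy]
        one_mem' := fun p ↦ rfl
        inv_mem' := fun {x} hx p ↦ by
          rw [← hx (x⁻¹ p), ← AlgEquiv.mul_apply, mul_inv_cancel, AlgEquiv.one_apply] }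
    have : Subgroup.zpowers σ ≤ D := by
      rw [Subgroup.zpowers_le]
      exact natDegree_affineSubst a b ha
    exact fun τ ↦ this τ.2
  have hdeg : ∀ g p, (γ g p).natDegree = p.natDegree := fun g p ↦ by
    rw [hγ, AlgEquiv.mul_apply]
    exact (natDegree_map (β g.1 : F →+* F)).trans (hdegσ _ _)
  have hγinj : Function.Injective γ := by
    rw [injective_iff_map_eq_one]
    intro g hg
    have h1 : g.1 = 1 := by
      apply hβ
      ext c
      have := hγC g c
      rw [hg] at this
      rw [map_one]
      exact (C_injective this).symm
    refine Prod.ext h1 (Subtype.ext ?_)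
    rw [hγ, h1, map_one, one_mul] at hg
    exact hg
  refine ⟨Subgroup.zpowers σ, inferInstance, ratFuncLift.comp γ, ⟨σ, Subgroup.mem_zpowers σ⟩, ?_, ?_,
    ?_, ratFuncLift_injective.comp hγinj, fun g x ↦ inftyValuation_ratFuncLift (hdeg g) x,
    fun g c ↦ ratFuncLift_C _ (hγC g c)⟩
  · rw [Nat.card_zpowers, hord]
  · exact fun h ↦ hab (congrArg Subtype.val h)
  · exact Subtype.ext habℓ

end RationalFunctions
end EssDim

namespace EssDim
universe u

/-! ### Normal subgroups of symmetric groups -/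

section SymmetricGroup

open Equiv

/-- `C` permutes itself by translation, on `ℓ` letters disjoint from the first `n`. -/
theorem exists_injective_perm_prod {n ℓ : ℕ} (C : Type u) [Group C] (hC : Nat.card C = ℓ)
    (hℓ : ℓ ≠ 0) :
    ∃ f : Perm (Fin n) × C →* Perm (Fin (n + ℓ)), Function.Injective f := by
  have : Finite C := Nat.finite_of_card_ne_zero (hC ▸ hℓ)
  have e : Fin n ⊕ C ≃ Fin (n + ℓ) :=
    (Equiv.sumCongr (Equiv.refl _) (Finite.equivFinOfCardEq hC)).trans finSumFinEquiv
  refine ⟨(e.permCongrHom.toMonoidHom.comp (Perm.sumCongrHom (Fin n) C)).comp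
    ((MonoidHom.id _).prodMap (MulAction.toPermHom C C)), ?_⟩
  refine (e.permCongrHom.injective.comp Perm.sumCongrHom_injective).comp ?_
  exact Function.Injective.prodMap Function.injective_id MulAction.toPerm_injective

theorem exists_injective_perm_of_le {n N : ℕ} (h : n ≤ N) :
    ∃ f : Perm (Fin n) →* Perm (Fin N), Function.Injective f :=
  ⟨Perm.viaEmbeddingHom (Fin.castLEEmb h), Perm.viaEmbeddingHom_injective _⟩

theorem alternatingGroup_le_of_ne_bot {n : ℕ} (hn : 5 ≤ n) {J : Subgroup (Perm (Fin n))} [J.Normal]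
    (hJ : J ≠ ⊥) : alternatingGroup (Fin n) ≤ J :=
  Perm.alternatingGroup_le_of_normal (by simpa using hn) (J.nontrivial_iff_ne_bot.2 hJ)

/-- For `n ≥ 5` a nontrivial `J` contains the alternating group, hence a double transposition. The
exception `n = 3` is genuine because of `A_3`. -/
theorem eq_bot_of_normal_of_two {n : ℕ} (hn : n ≠ 3) (J : Subgroup (Perm (Fin n))) [J.Normal]
    (h : ∀ g ∈ J, g ^ 2 = 1 → g = 1) : J = ⊥ := by
  by_cases h5 : 5 ≤ n
  · by_contra hJ
    have hle := alternatingGroup_le_of_ne_bot h5 hJ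
    let i : Fin 5 → Fin n := Fin.castLE h5
    have hi : ∀ a b, i a = i b ↔ a = b := fun a b ↦ (Fin.castLE_injective h5).eq_iff
    let g : Perm (Fin n) := swap (i 0) (i 1) * swap (i 2) (i 3)
    have hg : g ∈ alternatingGroup (Fin n) := by
      rw [Perm.mem_alternatingGroup, map_mul, Perm.sign_swap (by simp [hi]),
        Perm.sign_swap (by simp [hi])]
      rfl
    have hdis : Commute (swap (i 0) (i 1)) (swap (i 2) (i 3)) := by
      apply Perm.Disjoint.commute
      rw [Perm.disjoint_iff_disjoint_support, Perm.support_swap (by simp [hi]),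
        Perm.support_swap (by simp [hi])]
      simp [hi]
    have h1 := h g (hle hg) (by rw [hdis.mul_pow, sq, sq, swap_mul_self, swap_mul_self, one_mul])
    have h2 := Perm.congr_fun h1 (i 0)
    simp [g, swap_apply_of_ne_of_ne, hi] at h2
  · rw [Subgroup.eq_bot_iff_forall]
    intro g hg
    -- Unless `g ^ 2 = 1`, some conjugate of `g` times `g` is an involution, and this product lies
    -- in every normal subgroup containing `g`.
    have key : ∀ n < 5, n ≠ 3 → ∀ g : Perm (Fin n),
        g ^ 2 = 1 ∨ ∃ k : Perm (Fin n), k * g * k⁻¹ * g ≠ 1 ∧ (k * g * k⁻¹ * g) ^ 2 = 1 := by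
      intro n hn h3
      interval_cases n
      · decide
      · decide
      · decide
      · exact (h3 rfl).elim
      · decide +kernel
    rcases key n (by omega) hn g with h1 | ⟨k, h1, h2⟩
    · exact h g hg h1
    · exact (h1 (h _ (mul_mem (Subgroup.Normal.conj_mem inferInstance g hg k) hg) h2)).elim

/-- The same argument with three-cycles. The excluded cases have the normal 2-subgroups `S_2` and
the Klein four-group in `S_4`. -/
theorem eq_bot_of_normal_of_three {n : ℕ} (hn2 : n ≠ 2) (hn4 : n ≠ 4)
    (J : Subgroup (Perm (Fin n))) [J.Normal] (h : ∀ g ∈ J, g ^ 3 = 1 → g = 1) : J = ⊥ := by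
  by_cases h5 : 5 ≤ n
  · by_contra hJ
    have hle := alternatingGroup_le_of_ne_bot h5 hJ
    let i : Fin 5 → Fin n := Fin.castLE h5
    have hi : ∀ a b, i a = i b ↔ a = b := fun a b ↦ (Fin.castLE_injective h5).eq_iff
    have h3 : (swap (i 0) (i 1) * swap (i 0) (i 2)).IsThreeCycle :=
      Perm.isThreeCycle_swap_mul_swap_same (by simp [hi]) (by simp [hi]) (by simp [hi])
    have h1 := h _ (hle h3.mem_alternatingGroup) (h3.orderOf ▸ pow_orderOf_eq_one _)
    have := h3.orderOf
    rw [h1, orderOf_one] at this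
    omega
  · rw [Subgroup.eq_bot_iff_forall]
    intro g hg
    have key : ∀ n < 5, n ≠ 2 → n ≠ 4 → ∀ g : Perm (Fin n),
        g ^ 3 = 1 ∨ ∃ k : Perm (Fin n), k * g * k⁻¹ * g ≠ 1 ∧ (k * g * k⁻¹ * g) ^ 3 = 1 := by
      intro n hn h2 h4
      interval_cases n
      · decide
      · decide
      · exact (h2 rfl).elim
      · decide +kernel
      · exact (h4 rfl).elim
    rcases key n (by omega) hn2 hn4 g with h1 | ⟨k, h1, h2⟩
    · exact h g hg h1
    · exact (h1 (h _ (mul_mem (Subgroup.Normal.conj_mem inferInstance g hg k) hg) h2)).elim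

end SymmetricGroup

/-! ### The tame induction step -/

section Tame

open MvPolynomial

variable {K : Type u} [Field K] {m : ℕ} {G : Type*} [Group G]

theorem fieldAction_injective {ρ : G →* GL (Fin m) K} (hρ : Function.Injective ρ) :
    Function.Injective (fieldAction ρ) := by
  refine (IsFractionRing.fieldEquivOfAlgEquivHom_injective K _ K (RatFunField K m)).comp ?_
  intro g h hgh
  have h1 : ∀ i j, (ρ g⁻¹ : Matrix (Fin m) (Fin m) K) i j = (ρ h⁻¹ : Matrix (Fin m) (Fin m) K) i j := by
    intro i j
    have h2 := congrArg (coeff (Finsupp.single j 1)) (DFunLike.congr_fun hgh (X i))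
    rw [polyAction_X, polyAction_X] at h2
    simpa [coeff_sum, coeff_C_mul, coeff_X, Finsupp.single_left_inj] using h2
  have h3 : ρ g⁻¹ = ρ h⁻¹ := Units.ext (Matrix.ext h1)
  exact inv_injective (hρ h3)

theorem fieldAction_comp {H : Type*} [Group H] (ρ : G →* GL (Fin m) K) (f : H →* G) :
    fieldAction (ρ.comp f) = (fieldAction ρ).comp f := by
  have : polyAction (ρ.comp f) = (polyAction ρ).comp f := by
    ext h p : 2
    change linSubst _ p = linSubst _ p
    rw [MonoidHom.comp_apply, map_inv f]
  rw [fieldAction, this]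
  rfl

theorem exists_isStableFaithful_comp {L : Type u} [Field L] [Algebra K L] {H : Type*} [Group H]
    [Finite H] [Infinite L] {α : H →* (L ≃ₐ[K] L)} (hα : Function.Injective α)
    (ρ : G →* GL (Fin m) K) {f : H →* G} (hf : Function.Injective f)
    {E : IntermediateField K (RatFunField K m)} (hE : IsStableFaithful (fieldAction ρ) E) :
    ∃ E' : IntermediateField K L, IsStableFaithful α E' ∧
      Algebra.trdeg K E' ≤ Algebra.trdeg K E := by
  have := hE.comp hf
  rw [← fieldAction_comp] at this
  exact exists_isStableFaithful_of_fieldAction _ hα (infinite_fixed α) this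

instance (F : Type*) [Field F] : Infinite (RatFunc F) :=
  Infinite.of_injective _ (IsFractionRing.injective (Polynomial F) (RatFunc F))

/-- Restrict to `S_n × C_ℓ`, specialize to `F(t)` and take the residue field at infinity. An element
of order `ℓ` in the kernel of `S_n` would lie in the second factor as well, so `hgrp` makes the
kernel trivial. -/
theorem exists_isStableFaithful_of_tame {F : Type u} [Field F] [Algebra K F] {n ℓ : ℕ}
    {β : Equiv.Perm (Fin n) →* (F ≃ₐ[K] F)} (hβ : Function.Injective β) (hℓ : ℓ.Prime)
    (hℓK : (ℓ : K) ≠ 0) {a b : K} (ha : a ≠ 0) (hab : affineSubst F a b ha ≠ 1)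
    (habℓ : affineSubst F a b ha ^ ℓ = 1)
    (hgrp : ∀ J : Subgroup (Equiv.Perm (Fin n)), J.Normal → (∀ g ∈ J, g ^ ℓ = 1 → g = 1) → J = ⊥)
    (ρ : Equiv.Perm (Fin (n + ℓ)) →* GL (Fin m) K)
    {E : IntermediateField K (RatFunField K m)} (hE : IsStableFaithful (fieldAction ρ) E) :
    ∃ E' : IntermediateField K F, IsStableFaithful β E' ∧
      Algebra.trdeg K E' + 1 ≤ Algebra.trdeg K E := by
  classical
  obtain ⟨C, _, α, τ, hC, hτ, hτℓ, hα, hv, hαβ⟩ := exists_action_ratFunc hβ ha hab hℓ habℓ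
  obtain ⟨f, hf⟩ := exists_injective_perm_prod (n := n) C hC hℓ.ne_zero
  have : Finite C := Nat.finite_of_card_ne_zero (hC ▸ hℓ.ne_zero)
  obtain ⟨E₁, hE₁, hle⟩ := exists_isStableFaithful_comp hα ρ hf hE
  have hF : ∀ c : F, c ≠ 0 → RatFunc.inftyValuation F (algebraMap F (RatFunc F) c) = 1 :=
    fun c ↦ inftyValuation_algebraMap
  have hαβ' : ∀ g c, α g (algebraMap F (RatFunc F) c) =
      algebraMap F (RatFunc F) ((β.comp (MonoidHom.fst _ C)) g c) := hαβ
  obtain ⟨htr, hker⟩ := residueSubfield_of_tame hF (fun x ↦ exists_hasResidue_inftyValuation) hv hαβ'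
    hE₁ (τ := (1, τ)) (fun h ↦ hτ (congrArg Prod.snd h)) (map_one β) hℓ hℓK
    (Prod.ext (one_pow _) hτℓ)
  have hst : ∀ h, ∀ c ∈ residueSubfield hF E₁, β h c ∈ residueSubfield hF E₁ := fun h c hc ↦
    residueSubfield_stable hF hv hαβ' hE₁.1 (h, 1) hc
  refine ⟨residueSubfield hF E₁, ⟨hst, ?_⟩, htr.trans hle⟩
  let J : Subgroup (Equiv.Perm (Fin n)) :=
    { carrier := {h | ∀ c ∈ residueSubfield hF E₁, β h c = c}
      mul_mem' := fun {x y} hx hy c hc ↦ by rw [map_mul, AlgEquiv.mul_apply, hy c hc, hx c hc]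
      one_mem' := fun c _ ↦ by rw [map_one, AlgEquiv.one_apply]
      inv_mem' := fun {x} hx c hc ↦ by
        nth_rewrite 1 [← hx c hc]
        rw [← AlgEquiv.mul_apply, ← map_mul, inv_mul_cancel, map_one, AlgEquiv.one_apply] }
  have hJn : J.Normal := ⟨fun x hx k c hc ↦ by
    rw [map_mul, map_mul, AlgEquiv.mul_apply, AlgEquiv.mul_apply, hx _ (hst k⁻¹ c hc),
      ← AlgEquiv.mul_apply, ← map_mul, mul_inv_cancel, map_one, AlgEquiv.one_apply]⟩
  have hJ : J = ⊥ := hgrp J hJn fun g hg hgℓ ↦ by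
    have h1 := hker (g, 1) (Prod.ext (Commute.one_right g) (Commute.one_left τ))
      (Prod.ext hgℓ (one_pow _)) hg
    obtain ⟨k, hk⟩ := h1
    have := congrArg Prod.fst hk
    simpa using this.symm
  intro g hg
  have : g ∈ J := hg
  rwa [hJ, Subgroup.mem_bot] at this

theorem repEssDim_add_one_le_of_tame {n ℓ m' : ℕ} {ρ : Equiv.Perm (Fin n) →* GL (Fin m) K}
    (hρ : Function.Injective ρ) {ρ' : Equiv.Perm (Fin (n + ℓ)) →* GL (Fin m') K}
    (hρ' : Function.Injective ρ') (hℓ : ℓ.Prime)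
    (hℓK : (ℓ : K) ≠ 0) {a b : K} (ha : a ≠ 0)
    (hab : affineSubst (RatFunField K m) a b ha ≠ 1)
    (habℓ : affineSubst (RatFunField K m) a b ha ^ ℓ = 1)
    (hgrp : ∀ J : Subgroup (Equiv.Perm (Fin n)), J.Normal → (∀ g ∈ J, g ^ ℓ = 1 → g = 1) → J = ⊥) :
    repEssDim ρ + 1 ≤ repEssDim ρ' := by
  obtain ⟨E, hE, hle⟩ := exists_isStableFaithful_trdeg_le_extEssDim (fieldAction_injective hρ')
  obtain ⟨E', hE', hle'⟩ := exists_isStableFaithful_of_tame (fieldAction_injective hρ) hℓ hℓK ha hab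
    habℓ hgrp ρ' hE
  have h1 : repEssDim ρ ≤ Algebra.trdeg K E' :=
    extEssDim_le_of_isStableFaithful (fieldAction_injective hρ) hE'
  calc repEssDim ρ + 1 ≤ Algebra.trdeg K E' + 1 := by gcongr
    _ ≤ _ := hle'.trans hle

end Tame
end EssDim

namespace EssDim
open MvPolynomial
universe u

/-! ### Permutation representation, monotonicity, and `ed(S_n) ≤ 1` for `n = 2, 3` -/

section Permutation

variable (K : Type u) [Field K]

/-- The permutation representation of the symmetric group. -/
def permMatrixHom (n : ℕ) : Equiv.Perm (Fin n) →* Matrix (Fin n) (Fin n) K where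
  toFun σ := Matrix.of fun i j ↦ if i = σ j then 1 else 0
  map_one' := by
    ext i j
    simp [Matrix.one_apply]
    congr
  map_mul' σ τ := by
    ext i j
    simp [Matrix.mul_apply]
    congr

/-- The permutation representation of the symmetric group, by invertible matrices. -/
def permRep (n : ℕ) : Equiv.Perm (Fin n) →* GL (Fin n) K := (permMatrixHom K n).toHomUnits

theorem permRep_apply {n : ℕ} (σ : Equiv.Perm (Fin n)) (i j : Fin n) :
    (permRep K n σ : Matrix (Fin n) (Fin n) K) i j = if i = σ j then 1 else 0 := rfl

theorem permRep_injective (n : ℕ) : Function.Injective (permRep K n) := fun σ τ h ↦ by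
  ext j : 1
  have h1 : (permRep K n σ : Matrix (Fin n) (Fin n) K) (σ j) j =
      (permRep K n τ : Matrix (Fin n) (Fin n) K) (σ j) j := by rw [h]
  rw [permRep_apply, permRep_apply, if_pos rfl] at h1
  by_contra hne
  rw [if_neg hne] at h1
  exact one_ne_zero h1

theorem polyAction_permRep_X {n : ℕ} (σ : Equiv.Perm (Fin n)) (i : Fin n) :
    polyAction (permRep K n) σ (X i) = X (σ i) := by
  rw [polyAction_X, Finset.sum_eq_single (σ i)]
  · rw [permRep_apply, if_pos (by simp), C_1, one_mul]
  · intro j _ hj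
    rw [permRep_apply, if_neg, map_zero, zero_mul]
    rintro rfl
    simp at hj
  · simp

variable {K}

theorem infinite_ratFunField {m : ℕ} (hm : m ≠ 0) : Infinite (RatFunField K m) := by
  have : Nonempty (Fin m) := ⟨⟨0, Nat.pos_of_ne_zero hm⟩⟩
  exact Infinite.of_injective _ (IsFractionRing.injective (MvPolynomial (Fin m) K) (RatFunField K m))

theorem dimension_ne_zero {n m : ℕ} (hn : 2 ≤ n) {ρ : Equiv.Perm (Fin n) →* GL (Fin m) K}
    (hρ : Function.Injective ρ) : m ≠ 0 := by
  rintro rfl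
  have : Nontrivial (Fin n) := Fin.nontrivial_iff_two_le.2 hn
  obtain ⟨σ, τ, h⟩ := exists_pair_ne (Equiv.Perm (Fin n))
  exact h (hρ (Subsingleton.elim _ _))

/-- The essential dimension of the symmetric groups is increasing, and does not depend on the
representation. -/
theorem repEssDim_mono {n N m m' : ℕ} (hn : 2 ≤ n) (hnN : n ≤ N)
    {ρ : Equiv.Perm (Fin n) →* GL (Fin m) K} (hρ : Function.Injective ρ)
    {ρ' : Equiv.Perm (Fin N) →* GL (Fin m') K} (hρ' : Function.Injective ρ') :
    repEssDim ρ ≤ repEssDim ρ' := by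
  obtain ⟨E, hE, hle⟩ := exists_isStableFaithful_trdeg_le_extEssDim (fieldAction_injective hρ')
  obtain ⟨f, hf⟩ := exists_injective_perm_of_le hnN
  have := infinite_ratFunField (K := K) (dimension_ne_zero hn hρ)
  obtain ⟨E', hE', hle'⟩ := exists_isStableFaithful_comp (fieldAction_injective hρ) ρ' hf hE
  exact (extEssDim_le_of_isStableFaithful (fieldAction_injective hρ) hE').trans (hle'.trans hle)

open IntermediateField in
theorem trdeg_adjoin_simple_le {L : Type u} [Field L] [Algebra K L] (x : L) :
    Algebra.trdeg K K⟮x⟯ ≤ 1 := by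
  refine (trdeg_le_mk_of_isAlgebraic_adjoin (s := {x}) fun y hy ↦ ?_).trans
    (Cardinal.mk_singleton x).le
  rw [← IntermediateField.isAlgebraic_adjoin_iff]
  exact isAlgebraic_algebraMap (⟨y, hy⟩ : K⟮x⟯)

open IntermediateField in
/-- The ratio of differences of three permuted elements generates a faithful subfield of
transcendence degree at most one. -/
theorem exists_isStableFaithful_trdeg_le_one {L : Type u} [Field L] [Algebra K L] [Infinite L]
    {H : Type*} [Group H] [Finite H] {α : H →* (L ≃ₐ[K] L)} (hα : Function.Injective α)
    {f : H →* Equiv.Perm (Fin 3)} (hf : Function.Injective f) :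
    ∃ E : IntermediateField K L, IsStableFaithful α E ∧ Algebra.trdeg K E ≤ 1 := by
  classical
  -- The numerator of `σ λ - λ` for `λ = (x₀ - x₁) / (x₀ - x₂)`.
  let q : Equiv.Perm (Fin 3) → MvPolynomial (Fin 3) K := fun σ ↦
    (X (σ 0) - X (σ 1)) * (X 0 - X 2) - (X (σ 0) - X (σ 2)) * (X 0 - X 1)
  have hq : ∀ σ, σ ≠ 1 → q σ ≠ 0 := by
    have hcases : ∀ σ : Equiv.Perm (Fin 3), σ ≠ 1 →
        (σ 0 = 0 ∧ σ 1 = 2 ∧ σ 2 = 1) ∨ (σ 0 = 1 ∧ σ 1 = 0 ∧ σ 2 = 2) ∨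
        (σ 0 = 1 ∧ σ 1 = 2 ∧ σ 2 = 0) ∨ (σ 0 = 2 ∧ σ 1 = 0 ∧ σ 2 = 1) ∨
        (σ 0 = 2 ∧ σ 1 = 1 ∧ σ 2 = 0) := by decide
    intro σ hσ h0
    -- At `(0, 1, T)` the constant coefficient settles all cases except the transposition of `0` and
    -- `2`; there the coefficient `-1` of `T²` works in every characteristic.
    have h1 := congrArg (aeval ![(0 : Polynomial K), 1, Polynomial.X]) h0
    have hT : ∀ n, (Polynomial.X ^ 2 : Polynomial K).coeff n = if n = 2 then 1 else 0 :=
      fun n ↦ Polynomial.coeff_X_pow 2 n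
    rcases hcases σ hσ with ⟨a, b, c⟩ | ⟨a, b, c⟩ | ⟨a, b, c⟩ | ⟨a, b, c⟩ | ⟨a, b, c⟩
    · have h2 := congrArg (fun p ↦ Polynomial.coeff p 0) h1
      simp [q, a, b, c] at h2
    · have h2 := congrArg (fun p ↦ Polynomial.coeff p 0) h1
      simp [q, a, b, c] at h2
    · have h2 := congrArg (fun p ↦ Polynomial.coeff p 0) h1
      simp [q, a, b, c] at h2
    · have h2 := congrArg (fun p ↦ Polynomial.coeff p 0) h1
      simp [q, a, b, c] at h2
    · have h3 : aeval ![(0 : Polynomial K), 1, Polynomial.X] (q σ) =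
          -Polynomial.X ^ 2 + 2 * Polynomial.X := by
        simp [q, a, b, c]
        ring
      rw [h3] at h1
      have h2 := congrArg (fun p ↦ Polynomial.coeff p 2) h1
      simp [Polynomial.coeff_X, Polynomial.coeff_ofNat_mul] at h2
  have hX : ∀ i j : Fin 3, i ≠ j → (X i - X j : MvPolynomial (Fin 3) K) ≠ 0 := fun i j hij h ↦
    hij (X_injective (sub_eq_zero.1 h))
  let p : MvPolynomial (Fin 3) K := (∏ σ, if σ = 1 then 1 else q σ) *
    ∏ ij : Fin 3 × Fin 3, if ij.1 = ij.2 then 1 else (X ij.1 - X ij.2)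
  have hp : p ≠ 0 := by
    refine mul_ne_zero (Finset.prod_ne_zero_iff.2 fun σ _ ↦ ?_)
      (Finset.prod_ne_zero_iff.2 fun ij _ ↦ ?_)
    · split_ifs with h
      · exact one_ne_zero
      · exact hq σ h
    · split_ifs with h
      · exact one_ne_zero
      · exact hX _ _ h
  obtain ⟨φ, hφ, hφp⟩ := exists_equivariant_algHom ((permRep K 3).comp f) hα (infinite_fixed α) hp
  rw [map_mul, map_prod, map_prod] at hφp
  have hφq : ∀ σ, σ ≠ 1 → φ (q σ) ≠ 0 := fun σ hσ ↦ by
    have := Finset.prod_ne_zero_iff.1 (left_ne_zero_of_mul hφp) σ (Finset.mem_univ _)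
    rwa [if_neg hσ] at this
  let x : Fin 3 → L := fun i ↦ φ (X i)
  have hx : ∀ i j, i ≠ j → x i - x j ≠ 0 := fun i j hij ↦ by
    have := Finset.prod_ne_zero_iff.1 (right_ne_zero_of_mul hφp) (i, j) (Finset.mem_univ _)
    rwa [if_neg hij, map_sub] at this
  have hαx : ∀ g i, α g (x i) = x (f g i) := fun g i ↦ by
    have h1 : polyAction ((permRep K 3).comp f) g (X i) = polyAction (permRep K 3) (f g) (X i) := by
      rw [polyAction_X, polyAction_X, MonoidHom.comp_apply, map_inv f]
    rw [← hφ, h1, polyAction_permRep_X]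
  let lam : L := (x 0 - x 1) / (x 0 - x 2)
  have h02 : x 0 - x 2 ≠ 0 := hx 0 2 (by decide)
  have hαlam : ∀ g, α g lam = (x (f g 0) - x (f g 1)) / (x (f g 0) - x (f g 2)) := fun g ↦ by
    simp only [lam, map_div₀, map_sub, hαx]
  -- An affine change of coordinate moves the three elements to `0`, `-λ`, `-1`, and `λ` and its
  -- conjugates are affine invariants of the triple.
  have hs : ∀ i, (x i - x 0) / (x 0 - x 2) ∈ K⟮lam⟯ := by
    intro i
    fin_cases i
    · simp
    · have h1 : (x 1 - x 0) / (x 0 - x 2) = -lam := by simp only [lam]; ring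
      change (x 1 - x 0) / (x 0 - x 2) ∈ _
      rw [h1]
      exact neg_mem (mem_adjoin_simple_self K lam)
    · have h1 : (x 2 - x 0) / (x 0 - x 2) = -1 := by field_simp; ring
      change (x 2 - x 0) / (x 0 - x 2) ∈ _
      rw [h1]
      exact neg_mem (one_mem _)
  have hmem : ∀ g, α g lam ∈ K⟮lam⟯ := fun g ↦ by
    have h1 : ∀ i j, (x i - x j) / (x 0 - x 2) ∈ K⟮lam⟯ := fun i j ↦ by
      have : (x i - x j) / (x 0 - x 2) =
          (x i - x 0) / (x 0 - x 2) - (x j - x 0) / (x 0 - x 2) := by ring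
      rw [this]
      exact sub_mem (hs i) (hs j)
    rw [hαlam, ← div_div_div_cancel_right₀ h02]
    exact div_mem (h1 _ _) (h1 _ _)
  refine ⟨K⟮lam⟯, ⟨fun g y hy ↦ ?_, fun g hg ↦ ?_⟩, trdeg_adjoin_simple_le lam⟩
  · have hle : K⟮lam⟯ ≤ K⟮lam⟯.comap (α g : L →ₐ[K] L) := by
      rw [adjoin_simple_le_iff]
      exact hmem g
    exact hle hy
  · by_contra hg1
    have hfg : f g ≠ 1 := fun h ↦ hg1 (hf (by rw [h, map_one]))
    refine hφq (f g) hfg ?_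
    have h1 := hg lam (mem_adjoin_simple_self K lam)
    have hne : x (f g 0) - x (f g 2) ≠ 0 := hx _ _ (by simp)
    rw [hαlam, div_eq_div_iff hne h02] at h1
    simp only [q, map_sub, map_mul]
    change (x (f g 0) - x (f g 1)) * (x 0 - x 2) - (x (f g 0) - x (f g 2)) * (x 0 - x 1) = 0
    rw [h1]
    ring

theorem repEssDim_le_one {n m : ℕ} (hn : 2 ≤ n) (hn3 : n ≤ 3)
    {ρ : Equiv.Perm (Fin n) →* GL (Fin m) K} (hρ : Function.Injective ρ) : repEssDim ρ ≤ 1 := by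
  have := infinite_ratFunField (K := K) (dimension_ne_zero hn hρ)
  obtain ⟨f, hf⟩ := exists_injective_perm_of_le hn3
  obtain ⟨E, hE, hle⟩ := exists_isStableFaithful_trdeg_le_one (fieldAction_injective hρ) hf
  exact (extEssDim_le_of_isStableFaithful (fieldAction_injective hρ) hE).trans hle

end Permutation
end EssDim

namespace EssDim
universe u

/-! ### Base change -/

section BaseChange

variable {K K' L : Type u} [Field K] [Field K'] [Field L] [Algebra K K'] [Algebra K L]
  [Algebra K' L] [IsScalarTower K K' L]

theorem isAlgebraic_adjoin_of_tower {s : Set L} {x : L} (h : IsAlgebraic (Algebra.adjoin K s) x) :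
    IsAlgebraic (Algebra.adjoin K' s) x := by
  have hle : Algebra.adjoin K s ≤ (Algebra.adjoin K' s).restrictScalars K :=
    Algebra.adjoin_le Algebra.subset_adjoin
  exact h.ringHom_of_comp_eq (Subalgebra.inclusion hle : Algebra.adjoin K s →ₐ[K] _) (RingHom.id L)
    (Subalgebra.inclusion_injective hle) rfl

theorem trdeg_adjoin_le_of_tower (E : IntermediateField K L) :
    Algebra.trdeg K' (IntermediateField.adjoin K' (E : Set L)) ≤ Algebra.trdeg K E := by
  obtain ⟨s, hs, hE⟩ := exists_set_mk_eq_trdeg E.toSubalgebra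
  refine (trdeg_le_mk_of_isAlgebraic_adjoin fun x hx ↦ ?_).trans hs.le
  induction hx using IntermediateField.adjoin_induction with
  | mem x hx =>
    exact isAlgebraic_adjoin_of_tower (K := K)
      (hE x (isAlgebraic_algebraMap (⟨x, hx⟩ : E.toSubalgebra)))
  | algebraMap c => exact isAlgebraic_algebraMap (algebraMap K' (Algebra.adjoin K' s) c)
  | add x y _ _ hx hy => exact hx.add hy
  | inv x _ hx => exact hx.inv
  | mul x y _ _ hx hy => exact hx.mul hy

theorem IsStableFaithful.baseChange {G : Type*} [Group G] {α : G →* (L ≃ₐ[K'] L)}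
    {E : IntermediateField K L}
    (hE : IsStableFaithful ((AlgEquiv.restrictScalarsHom K).comp α) E) :
    IsStableFaithful α (IntermediateField.adjoin K' (E : Set L)) := by
  refine ⟨fun g x hx ↦ ?_, fun g hg ↦ hE.2 g fun x hx ↦
    hg x (IntermediateField.subset_adjoin _ _ hx)⟩
  have hle : IntermediateField.adjoin K' (E : Set L) ≤
      (IntermediateField.adjoin K' (E : Set L)).comap (α g : L →ₐ[K'] L) := by
    rw [IntermediateField.adjoin_le_iff]
    exact fun y hy ↦ IntermediateField.subset_adjoin _ _ (hE.1 g y hy)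
  exact hle hx

/-- A stable faithful subfield over `K` specializes into `K'(x₁, …, x_n)` regarded over `K`; its
compositum with `K'` has no larger transcendence degree over `K'`. -/
theorem repEssDim_permRep_le_of_tower {n m : ℕ} (hn : n ≠ 0)
    {ρ : Equiv.Perm (Fin n) →* GL (Fin m) K} (hρ : Function.Injective ρ) :
    repEssDim (permRep K' n) ≤ repEssDim ρ := by
  obtain ⟨E, hE, hle⟩ := exists_isStableFaithful_trdeg_le_extEssDim (fieldAction_injective hρ)
  have := infinite_ratFunField (K := K') hn
  have hinj := fieldAction_injective (permRep_injective K' n)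
  let α := fieldAction (permRep K' n)
  have hα : Function.Injective ((AlgEquiv.restrictScalarsHom K).comp α) := fun g h hgh ↦ hinj (by
    ext x
    exact DFunLike.congr_fun hgh x)
  obtain ⟨E', hE', hle'⟩ := exists_isStableFaithful_comp hα ρ Function.injective_id
    (f := MonoidHom.id _) hE
  exact (extEssDim_le_of_isStableFaithful hinj hE'.baseChange).trans
    ((trdeg_adjoin_le_of_tower E').trans (hle'.trans hle))

end BaseChange

/-! ### Affine substitutions of finite order -/

section Affine

open Polynomial

variable {K F : Type u} [Field K] [Field F] [Algebra K F]

theorem affineSubst_ne_one {a b : K} (ha : a ≠ 0) (h : a ≠ 1 ∨ b ≠ 0) :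
    affineSubst F a b ha ≠ 1 := by
  intro h1
  have h2 := DFunLike.congr_fun h1 (X : F[X])
  rw [affineSubst_apply, X_comp, AlgEquiv.one_apply] at h2
  rcases h with h | h
  · have := congrArg (fun p ↦ coeff p 1) h2
    simp [coeff_C] at this
    exact h this
  · have := congrArg (fun p ↦ coeff p 0) h2
    simp at this
    exact h this

theorem affineSubst_zero_pow {a : K} (ha : a ≠ 0) {n : ℕ} (h : a ^ n = 1) :
    affineSubst F a 0 ha ^ n = 1 := by
  have key : ∀ k (p : F[X]), (affineSubst F a 0 ha ^ k) p = p.comp (C (algebraMap K F a ^ k) * X) := by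
    intro k
    induction k with
    | zero => simp
    | succ k ih =>
      intro p
      rw [pow_succ, AlgEquiv.mul_apply, ih, affineSubst_apply, comp_assoc, pow_succ]
      simp [mul_assoc, mul_left_comm]
  ext p : 1
  rw [key, ← map_pow, h]
  simp

theorem affineSubst_one_sq [CharP K 2] : affineSubst F (1 : K) 1 one_ne_zero ^ 2 = 1 := by
  have : CharP F 2 := charP_of_injective_algebraMap (algebraMap K F).injective 2
  ext p : 1
  rw [sq, AlgEquiv.mul_apply, affineSubst_apply, affineSubst_apply, comp_assoc]
  have : (C (algebraMap K F 1) * X + C (algebraMap K F 1)).comp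
      (C (algebraMap K F 1) * X + C (algebraMap K F 1)) = X := by
    simp [add_assoc, CharTwo.add_self_eq_zero]
  rw [this, comp_X, AlgEquiv.one_apply]

end Affine

/-! ### The numerical bounds -/

section Bounds

variable {K : Type u} [Field K]

theorem repEssDim_add_one_le_two {n m m' : ℕ} (h2 : (2 : K) ≠ 0) (hn : n ≠ 3)
    {ρ : Equiv.Perm (Fin n) →* GL (Fin m) K} (hρ : Function.Injective ρ)
    {ρ' : Equiv.Perm (Fin (n + 2)) →* GL (Fin m') K} (hρ' : Function.Injective ρ') :
    repEssDim ρ + 1 ≤ repEssDim ρ' := by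
  have hne : (-1 : K) ≠ 1 := fun h ↦ h2 (by linear_combination -h)
  exact repEssDim_add_one_le_of_tame hρ hρ' Nat.prime_two (by exact_mod_cast h2)
    (neg_ne_zero.2 one_ne_zero) (affineSubst_ne_one _ (Or.inl hne)) (affineSubst_zero_pow _ (by norm_num))
    fun J hJ h ↦ eq_bot_of_normal_of_two hn J h

theorem repEssDim_add_one_le_three {n m m' : ℕ} (h3 : (3 : K) ≠ 0) {ω : K} (hω1 : ω ≠ 1)
    (hω : ω ^ 3 = 1) (hn2 : n ≠ 2) (hn4 : n ≠ 4)
    {ρ : Equiv.Perm (Fin n) →* GL (Fin m) K} (hρ : Function.Injective ρ)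
    {ρ' : Equiv.Perm (Fin (n + 3)) →* GL (Fin m') K} (hρ' : Function.Injective ρ') :
    repEssDim ρ + 1 ≤ repEssDim ρ' := by
  have hω0 : ω ≠ 0 := by
    rintro rfl
    norm_num at hω
  exact repEssDim_add_one_le_of_tame hρ hρ' Nat.prime_three (by exact_mod_cast h3)
    hω0 (affineSubst_ne_one _ (Or.inl hω1)) (affineSubst_zero_pow _ hω)
    fun J hJ h ↦ eq_bot_of_normal_of_three hn2 hn4 J h

theorem natCast_div_two_le_repEssDim (h2 : (2 : K) ≠ 0) :
    ∀ (n m : ℕ) (ρ : Equiv.Perm (Fin n) →* GL (Fin m) K), Function.Injective ρ →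
      ((n / 2 : ℕ) : Cardinal) ≤ repEssDim ρ := by
  intro n
  induction n using Nat.strong_induction_on with
  | _ n ih =>
    intro m ρ hρ
    by_cases hn : n < 2
    · rw [Nat.div_eq_of_lt hn, Nat.cast_zero]
      exact zero_le
    obtain ⟨k, rfl⟩ := Nat.exists_eq_add_of_le' (not_lt.1 hn)
    -- The step from `S_3` to `S_5` is unavailable, but `5 / 2 = 4 / 2`, so monotonicity from `S_4`
    -- suffices.
    by_cases hk : k = 3
    · subst hk
      exact (ih 4 (by norm_num) 4 (permRep K 4) (permRep_injective K 4)).trans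
        (repEssDim_mono (by norm_num) (by norm_num) (permRep_injective K 4) hρ)
    · rw [Nat.add_div_right k (by norm_num), Nat.cast_add, Nat.cast_one]
      refine le_trans ?_ (repEssDim_add_one_le_two h2 hk (permRep_injective K k) hρ)
      gcongr
      exact ih k (by omega) k _ (permRep_injective K k)

/-- The essential dimension of a nontrivial symmetric group is nonzero over an algebraically closed
field. -/
theorem one_le_trdeg [IsAlgClosed K] {L : Type u} [Field L] [Algebra K L] {G : Type*} [Group G]
    [Nontrivial G] {α : G →* (L ≃ₐ[K] L)} {E : IntermediateField K L} (hE : IsStableFaithful α E) :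
    1 ≤ Algebra.trdeg K E := by
  rw [Cardinal.one_le_iff_ne_zero]
  intro h0
  rw [trdeg_eq_zero_iff] at h0
  have hbot := IntermediateField.eq_bot_of_isAlgClosed_of_isAlgebraic E
  obtain ⟨g, hg⟩ := exists_ne (1 : G)
  refine hg (hE.2 g fun x hx ↦ ?_)
  rw [hbot, IntermediateField.mem_bot] at hx
  obtain ⟨c, rfl⟩ := hx
  exact (α g).commutes c

/-- Use `S_3 × C_2 ⊆ S_5` with `C_2` acting wildly by `t ↦ t + 1`. The residue field still loses one
dimension. Were it algebraic over `K`, it would equal `K` and be fixed by the group, contradicting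
that a three-cycle is conjugate to its inverse. -/
theorem two_le_repEssDim [IsAlgClosed K] [CharP K 2] {n m : ℕ} (hn : 5 ≤ n)
    {ρ : Equiv.Perm (Fin n) →* GL (Fin m) K} (hρ : Function.Injective ρ) :
    2 ≤ repEssDim ρ := by
  classical
  obtain ⟨E, hE, hle⟩ := exists_isStableFaithful_trdeg_le_extEssDim (fieldAction_injective hρ)
  let F := RatFunField K 3
  let β := fieldAction (permRep K 3)
  obtain ⟨C, _, α, τ, hC, hτ, hτ2, hα, hv, hαβ⟩ := exists_action_ratFunc (F := F) (β := β)
    (fieldAction_injective (permRep_injective K 3)) one_ne_zero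
    (affineSubst_ne_one (F := F) (a := (1 : K)) (b := 1) _ (Or.inr one_ne_zero)) Nat.prime_two
    affineSubst_one_sq
  obtain ⟨f, hf⟩ := exists_injective_perm_prod (n := 3) C hC two_ne_zero
  obtain ⟨f', hf'⟩ := exists_injective_perm_of_le hn
  have : Finite C := Nat.finite_of_card_ne_zero (hC ▸ two_ne_zero)
  obtain ⟨E₁, hE₁, hle₁⟩ := exists_isStableFaithful_comp hα ρ (f := f'.comp f) (hf'.comp hf) hE
  have hF : ∀ c : F, c ≠ 0 → RatFunc.inftyValuation F (algebraMap F (RatFunc F) c) = 1 :=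
    fun c ↦ inftyValuation_algebraMap
  have hαβ' : ∀ g c, α g (algebraMap F (RatFunc F) c) =
      algebraMap F (RatFunc F) ((β.comp (MonoidHom.fst _ C)) g c) := hαβ
  have hres := fun x ↦ exists_hasResidue_inftyValuation (F := F) (x := x)
  have hτ' : ((1, τ) : Equiv.Perm (Fin 3) × C) ≠ 1 := fun h ↦ hτ (congrArg Prod.snd h)
  have hβτ : (β.comp (MonoidHom.fst _ C)) (1, τ) = 1 := map_one β
  obtain ⟨π, hπ, hπ0, hπ1, -⟩ := exists_uniformizer
    (exists_valuation_ne_one hres hv hαβ' hE₁ hτ' hβτ)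
  have htr := trdeg_residueSubfield_add_one_le hF hπ hπ0 hπ1
  have h1 : 1 ≤ Algebra.trdeg K (residueSubfield hF E₁) := by
    rw [Cardinal.one_le_iff_ne_zero]
    intro h0
    rw [trdeg_eq_zero_iff] at h0
    have hbot := IntermediateField.eq_bot_of_isAlgClosed_of_isAlgebraic (residueSubfield hF E₁)
    have hfix : ∀ g, ∀ c ∈ residueSubfield hF E₁, (β.comp (MonoidHom.fst _ C)) g c = c := by
      intro g c hc
      rw [hbot, IntermediateField.mem_bot] at hc
      obtain ⟨d, rfl⟩ := hc
      exact AlgEquiv.commutes _ d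
    have h3 : ((3 : ℕ) : K) ≠ 0 := by
      rw [Ne, CharP.cast_eq_zero_iff K 2]
      norm_num
    have hc1 : (finRotate 3) ^ 3 = 1 := by decide
    have hc2 : Equiv.swap 0 1 * finRotate 3 = (finRotate 3)⁻¹ * Equiv.swap 0 1 := by decide
    have hc3 : finRotate 3 ≠ 1 := by decide
    have := eq_one_of_residueSubfield_fixed hF hres hv hαβ' hE₁ hτ' hβτ hfix (by decide) h3
      (g := (finRotate 3, 1)) (h := (Equiv.swap 0 1, 1))
      (Prod.ext hc1 (one_pow _)) (Prod.ext hc2 (by simp))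
    exact hc3 (congrArg Prod.fst this)
  calc (2 : Cardinal) = 1 + 1 := by norm_num
    _ ≤ Algebra.trdeg K (residueSubfield hF E₁) + 1 := by gcongr
    _ ≤ _ := htr.trans (hle₁.trans hle)

theorem exists_cube_root_of_isAlgClosed [IsAlgClosed K] (h3 : (3 : K) ≠ 0) :
    ∃ ω : K, ω ≠ 1 ∧ ω ^ 3 = 1 := by
  obtain ⟨ω, hω⟩ := IsAlgClosed.exists_root (Polynomial.X ^ 2 + Polynomial.X + 1 : Polynomial K) (by
    have : (Polynomial.X ^ 2 + Polynomial.X + 1 : Polynomial K).degree = 2 := by compute_degree!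
    rw [this]
    norm_num)
  simp only [Polynomial.IsRoot, Polynomial.eval_add, Polynomial.eval_pow, Polynomial.eval_X,
    Polynomial.eval_one] at hω
  refine ⟨ω, ?_, by linear_combination (ω - 1) * hω⟩
  rintro rfl
  exact h3 (by linear_combination hω)

/-- Algebraic closedness supplies a cube root of unity and the bound by one for `2 ≤ n < 5`.
Treating `5 ≤ n < 8` directly makes every induction step start at `k ≥ 5`, beyond the exceptions `2`
and `4`. -/
theorem natCast_div_three_le_of_isAlgClosed [IsAlgClosed K] [CharP K 2] :
    ∀ (n m : ℕ) (ρ : Equiv.Perm (Fin n) →* GL (Fin m) K), Function.Injective ρ →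
      (((n + 1) / 3 : ℕ) : Cardinal) ≤ repEssDim ρ := by
  have h3 : (3 : K) ≠ 0 := by
    have : ((3 : ℕ) : K) ≠ 0 := by
      rw [Ne, CharP.cast_eq_zero_iff K 2]
      norm_num
    exact_mod_cast this
  obtain ⟨ω, hω1, hω⟩ := exists_cube_root_of_isAlgClosed h3
  intro n
  induction n using Nat.strong_induction_on with
  | _ n ih =>
    intro m ρ hρ
    by_cases h2 : n < 2
    · rw [Nat.div_eq_of_lt (by omega), Nat.cast_zero]
      exact zero_le
    by_cases h5 : n < 5
    · have : (n + 1) / 3 = 1 := by omega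
      rw [this, Nat.cast_one]
      obtain ⟨E, hE, hle⟩ := exists_isStableFaithful_trdeg_le_extEssDim (fieldAction_injective hρ)
      have : Nontrivial (Fin n) := Fin.nontrivial_iff_two_le.2 (not_lt.1 h2)
      exact (one_le_trdeg hE).trans hle
    by_cases h8 : n < 8
    · have : (n + 1) / 3 = 2 := by omega
      rw [this]
      exact_mod_cast two_le_repEssDim (not_lt.1 h5) hρ
    obtain ⟨k, rfl⟩ := Nat.exists_eq_add_of_le' (show 3 ≤ n by omega)
    have : (k + 3 + 1) / 3 = (k + 1) / 3 + 1 := by omega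
    rw [this, Nat.cast_add, Nat.cast_one]
    refine le_trans ?_ (repEssDim_add_one_le_three h3 hω1 hω (by omega) (by omega)
      (permRep_injective K k) hρ)
    gcongr
    exact ih k (by omega) k _ (permRep_injective K k)

theorem natCast_div_three_le_repEssDim [CharP K 2] {n m : ℕ}
    {ρ : Equiv.Perm (Fin n) →* GL (Fin m) K} (hρ : Function.Injective ρ) :
    (((n + 1) / 3 : ℕ) : Cardinal) ≤ repEssDim ρ := by
  by_cases hn : n = 0
  · subst hn
    simp
  have : CharP (AlgebraicClosure K) 2 :=
    charP_of_injective_algebraMap (algebraMap K (AlgebraicClosure K)).injective 2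
  exact (natCast_div_three_le_of_isAlgClosed n n _ (permRep_injective (AlgebraicClosure K) n)).trans
    (repEssDim_permRep_le_of_tower hn hρ)

theorem exists_cube_root_of_galoisField (f : GaloisField 2 2 →+* K) :
    ∃ ω : K, ω ≠ 1 ∧ ω ^ 3 = 1 := by
  have hcard : Nat.card (GaloisField 2 2) = 4 := by rw [GaloisField.card 2 2 two_ne_zero]; norm_num
  have : Finite (GaloisField 2 2) := Nat.finite_of_card_ne_zero (by omega)
  cases nonempty_fintype (GaloisField 2 2)
  classical
  rw [Nat.card_eq_fintype_card] at hcard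
  obtain ⟨x, hx⟩ : ∃ x : GaloisField 2 2, x ∉ ({0, 1} : Finset (GaloisField 2 2)) := by
    by_contra! hcon
    have h1 := Finset.card_le_card (fun x _ ↦ hcon x :
      (Finset.univ : Finset (GaloisField 2 2)) ⊆ {0, 1})
    have h2 := Finset.card_le_two (a := (0 : GaloisField 2 2)) (b := 1)
    rw [Finset.card_univ, hcard] at h1
    omega
  simp only [Finset.mem_insert, Finset.mem_singleton, not_or] at hx
  refine ⟨f x, fun h ↦ hx.2 (f.injective (by rw [h, map_one])), ?_⟩
  have := FiniteField.pow_card_sub_one_eq_one x hx.1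
  rw [hcard] at this
  rw [← map_pow, this, map_one]

end Bounds
end EssDim

/-- `ed_K(G)` is `ed_K(K(V)/K(V)^G)` for a faithful representation `G → GL(V)`; each inequality is
asserted for all faithful representations computing the essential dimensions that occur in it. -/
theorem theorem5p4 (K : Type*) [Field K] :
    (ringChar K ≠ 2 →
      (∀ n : ℕ, 1 ≤ n →
        ∀ (m m' : ℕ) (ρ : Equiv.Perm (Fin n) →* GL (Fin m) K)
          (ρ' : Equiv.Perm (Fin (n + 2)) →* GL (Fin m') K),
          Function.Injective ρ → Function.Injective ρ' →
            EssDim.repEssDim ρ + 1 ≤ EssDim.repEssDim ρ') ∧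
      (∀ n : ℕ, 1 ≤ n →
        ∀ (m : ℕ) (ρ : Equiv.Perm (Fin n) →* GL (Fin m) K), Function.Injective ρ →
          ((n / 2 : ℕ) : Cardinal) ≤ EssDim.repEssDim ρ)) ∧
    (ringChar K = 2 → Nonempty (GaloisField 2 2 →+* K) →
      ∀ n : ℕ, n ≠ 4 →
        ∀ (m m' : ℕ) (ρ : Equiv.Perm (Fin n) →* GL (Fin m) K)
          (ρ' : Equiv.Perm (Fin (n + 3)) →* GL (Fin m') K),
          Function.Injective ρ → Function.Injective ρ' →
            EssDim.repEssDim ρ + 1 ≤ EssDim.repEssDim ρ') ∧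
    (ringChar K = 2 →
      ∀ n : ℕ, 1 ≤ n →
        ∀ (m : ℕ) (ρ : Equiv.Perm (Fin n) →* GL (Fin m) K), Function.Injective ρ →
          (((n + 1) / 3 : ℕ) : Cardinal) ≤ EssDim.repEssDim ρ) := by
  refine ⟨fun hchar ↦ ?_, fun hchar ⟨f⟩ n hn4 m m' ρ ρ' hρ hρ' ↦ ?_, fun hchar n _ m ρ hρ ↦ ?_⟩
  · have h2 : (2 : K) ≠ 0 := Ring.two_ne_zero hchar
    refine ⟨fun n _ m m' ρ ρ' hρ hρ' ↦ ?_, fun n _ ↦ EssDim.natCast_div_two_le_repEssDim h2 n⟩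
    -- Here `A_3` blocks the tame step; `ed(S_3) ≤ 1` and `ed(S_5) ≥ 2` replace it.
    by_cases hn : n = 3
    · subst hn
      have h1 := EssDim.repEssDim_le_one (by norm_num) le_rfl hρ
      have h5 := EssDim.natCast_div_two_le_repEssDim h2 5 m' ρ' hρ'
      calc EssDim.repEssDim ρ + 1 ≤ 1 + 1 := by gcongr
        _ = ((5 / 2 : ℕ) : Cardinal) := by norm_num
        _ ≤ _ := h5
    · exact EssDim.repEssDim_add_one_le_two h2 hn hρ hρ'
  · have : CharP K 2 := ringChar.of_eq hchar
    -- Here `S_2` has no element of order three; `ed(S_2) ≤ 1` and the bound `ed(S_5) ≥ 2` replace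
    -- the tame step.
    by_cases hn : n = 2
    · subst hn
      have h1 := EssDim.repEssDim_le_one le_rfl (by norm_num) hρ
      have h5 := EssDim.natCast_div_three_le_repEssDim hρ'
      calc EssDim.repEssDim ρ + 1 ≤ 1 + 1 := by gcongr
        _ = (((2 + 3 + 1) / 3 : ℕ) : Cardinal) := by norm_num
        _ ≤ _ := h5
    · obtain ⟨ω, hω1, hω⟩ := EssDim.exists_cube_root_of_galoisField f
      have h3 : ((3 : ℕ) : K) ≠ 0 := by
        rw [Ne, CharP.cast_eq_zero_iff K 2]
        norm_num
      exact EssDim.repEssDim_add_one_le_three (by exact_mod_cast h3) hω1 hω hn hn4 hρ hρ'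
  · have : CharP K 2 := ringChar.of_eq hchar
    exact EssDim.natCast_div_three_le_repEssDim hρ
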